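/- For $d\ge 0$ let $\mathcal Q_d$ be the $d$-cube: its vertex set $X$ is $\{-1,1\}^d$, two vertices being adjacent when they differ in exactly one coordinate. It is distance-regular of diameter $d$. Let $p^h_{ij}$ be its intersection numbers, $A_i$ its distance matrices, $\theta_0>\dots>\theta_d$ the distinct eigenvalues of its adjacency matrix, $E_i$ the primitive idempotent associated with $\theta_i$ (the matrix acting as the identity on the $\theta_i$-eigenspace and as $0$ on the other eigenspaces), and $(p^h_{ij})^*$ its Krein parameters, defined by $E_i\circ E_j=|X|^{-1}\sum_h (p^h_{ij})^*E_h$ (entrywise product). For a vertex $x$ let $E_i^*(x)$ be the diagonal matrix whose $(y,y)$-entry is $1$ if $x,y$ are at distance $i$ and $0$ otherwise, and $A_i^*(x)$ the diagonal matrix with $(y,y)$-entry $|X|(E_i)_{xy}$. Define scalars $q_i(j)$, $q_i^*(j)$ by $E_i=|X|^{-1}\sum_j q_i(j)A_j$ and $E_i^*(x)=|X|^{-1}\sum_j q_i^*(j)A_j^*(x)$ (the latter do not depend on $x$). The generalized Terwilliger algebra $\mathcal T_d$ of $\mathcal Q_d$ is the unital associative $\mathbb C$-algebra with generators $x_0,\dots,x_d,x_0^*,\dots,x_d^*$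 and relations, for $0\le h,i,j\le d$, $$x_0=x_0^*=1,\qquad x_ix_j=\sum_{h=0}^d p^h_{ij}x_h,\qquad x_i^*x_j^*=\sum_{h=0}^d (p^h_{ij})^*x_h^*,$$ $$e_h^*x_ie_j^*=0\ \text{ if } p^h_{ij}=0,\qquad e_hx_i^*e_j=0\ \text{ if } (p^h_{ij})^*=0,$$ where $e_i=|X|^{-1}\sum_j q_i(j)x_j$ and $e_i^*=|X|^{-1}\sum_j q_i^*(j)x_j^*$. Put $k_i=p^0_{ii}$, $k_i^*=(p^0_{ii})^*$ and $$u_0=2^d\sum_{i=0}^d k_i^{-1}e_i^*e_0e_i^*\in\mathcal T_d .$$ Let $d\ge 2$. Then also $u_0=2^d\sum_{i=0}^d (k_i^*)^{-1}e_ie_0^*e_i$, the element $u_0$ is a central idempotent of $\mathcal T_d$ (the primary central idempotent), and there exists an isomorphism of $\mathbb C$-algebras $$\Psi:\mathcal T_d\to M_{d+1}(\mathbb C)\oplus\mathcal T_{d-2}$$ with $\Psi(u_0)=(1,0)$, which maps the two-sided ideal generated by $u_0$ onto $M_{d+1}(\mathbb C)\oplus 0$ and the two-sided ideal generated by $1-u_0$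 onto $0\oplus\mathcal T_{d-2}$. -/

import Mathlib

namespace Terwilliger

noncomputable section

open Matrix

open scoped Classical in
/-- The `d`-cube: vertices are the `d`-tuples with entries in `{-1, 1}` (the units of `ℤ`), and two
vertices are adjacent when they differ in exactly one coordinate. -/
def hypercube (d : ℕ) : SimpleGraph (Fin d → ℤˣ) where
  Adj a b := ∃! i, a i ≠ b i
  symm := ⟨fun _ _ h => by simpa only [ne_comm] using h⟩
  loopless := ⟨fun _ h => by obtain ⟨i, hi, _⟩ := h; exact hi rfl⟩

section Graph

/-! Parameters of a finite connected distance-regular graph `G` of diameter `G.diam`. Each scalar,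
and each matrix `E i`, below is *the* object with the stated property; existence and uniqueness hold
for distance-regular graphs, so that `Classical.epsilon` picks that object. -/

variable {V : Type*} [Fintype V] (G : SimpleGraph V)

/-- The intersection number `p^h_{ij}`: the number, independent of the choice of vertices `x`, `y`
at distance `h`, of vertices `z` with `∂(x,z) = i` and `∂(y,z) = j`. -/
def intersectionNumber (h i j : Fin (G.diam + 1)) : ℕ :=
  Classical.epsilon fun n : ℕ => ∀ x y : V, G.dist x y = h →
    Nat.card {z : V // G.dist x z = i ∧ G.dist y z = j} = n

open scoped Classical in
/-- The `i`-th distance matrix `A_i`. -/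
def distanceMatrix (i : Fin (G.diam + 1)) : Matrix V V ℂ :=
  Matrix.of fun x y => if G.dist x y = i then 1 else 0

open scoped Classical in
/-- The distinct eigenvalues `θ_0 > θ_1 > ⋯ > θ_D` of the adjacency matrix, `D = G.diam`. -/
def eigenvalue : Fin (G.diam + 1) → ℝ :=
  Classical.epsilon fun θ : Fin (G.diam + 1) → ℝ =>
    StrictAnti θ ∧ Set.range θ = spectrum ℝ (G.adjMatrix ℝ)

open scoped Classical in
/-- The primitive idempotent `E_i`: it acts as the identity on the `θ_i`-eigenspace of the adjacency
matrix and as zero on all the other eigenspaces. -/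
def primitiveIdempotent (i : Fin (G.diam + 1)) : Matrix V V ℂ :=
  Classical.epsilon fun E : Matrix V V ℂ =>
    (∀ v : V → ℂ, G.adjMatrix ℂ *ᵥ v = (eigenvalue G i : ℂ) • v → E *ᵥ v = v) ∧
    (∀ μ : ℂ, μ ≠ (eigenvalue G i : ℂ) →
      ∀ v : V → ℂ, G.adjMatrix ℂ *ᵥ v = μ • v → E *ᵥ v = 0)

/-- The Krein parameter `(p^h_{ij})^*`, for which
`E_i ∘ E_j = |X|⁻¹ ∑_h (p^h_{ij})^* E_h` (entrywise product). -/
def kreinParameter (h i j : Fin (G.diam + 1)) : ℂ :=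
  (Classical.epsilon fun c : Fin (G.diam + 1) → ℂ =>
    primitiveIdempotent G i ⊙ primitiveIdempotent G j =
      (Fintype.card V : ℂ)⁻¹ • ∑ l, c l • primitiveIdempotent G l) h

open scoped Classical in
/-- The dual primitive idempotent `E_i^*(x)` with respect to the vertex `x`. -/
def dualIdempotent (x : V) (i : Fin (G.diam + 1)) : Matrix V V ℂ :=
  Matrix.diagonal fun y => if G.dist x y = i then 1 else 0

open scoped Classical in
/-- The dual distance matrix `A_i^*(x)`: diagonal, with `(y,y)`-entry `|X| (E_i)_{xy}`. -/
def dualDistanceMatrix (x : V) (i : Fin (G.diam + 1)) : Matrix V V ℂ :=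
  Matrix.diagonal fun y => (Fintype.card V : ℂ) * primitiveIdempotent G i x y

/-- The scalars `q_i(j)`, for which `E_i = |X|⁻¹ ∑_j q_i(j) A_j`. -/
def q (i j : Fin (G.diam + 1)) : ℂ :=
  (Classical.epsilon fun c : Fin (G.diam + 1) → ℂ =>
    primitiveIdempotent G i = (Fintype.card V : ℂ)⁻¹ • ∑ l, c l • distanceMatrix G l) j

/-- The scalars `q_i^*(j)`, for which `E_i^*(x) = |X|⁻¹ ∑_j q_i^*(j) A_j^*(x)`
for every vertex `x` (they do not depend on `x`). -/
def qDual (i j : Fin (G.diam + 1)) : ℂ :=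
  (Classical.epsilon fun c : Fin (G.diam + 1) → ℂ => ∀ x : V,
    dualIdempotent G x i = (Fintype.card V : ℂ)⁻¹ • ∑ l, c l • dualDistanceMatrix G x l) j

/-- The valency `k_i = p^0_{ii}`. -/
def valency (i : Fin (G.diam + 1)) : ℕ := intersectionNumber G 0 i i

/-- The dual valency `k_i^* = (p^0_{ii})^*`. -/
def dualValency (i : Fin (G.diam + 1)) : ℂ := kreinParameter G 0 i i

/-- The generators `x_0, …, x_D, x_0^*, …, x_D^*`. -/
inductive Gen (n : ℕ) : Type
  | x (i : Fin n) : Gen n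
  | xDual (i : Fin n) : Gen n

/-- The free algebra on the generators. -/
abbrev Free : Type := FreeAlgebra ℂ (Gen (G.diam + 1))

/-- The generator `x_i` in the free algebra. -/
def freeX (i : Fin (G.diam + 1)) : Free G := FreeAlgebra.ι ℂ (Gen.x i)

/-- The generator `x_i^*` in the free algebra. -/
def freeXDual (i : Fin (G.diam + 1)) : Free G := FreeAlgebra.ι ℂ (Gen.xDual i)

/-- `e_i = |X|⁻¹ ∑_j q_i(j) x_j` in the free algebra. -/
def freeE (i : Fin (G.diam + 1)) : Free G :=
  (Fintype.card V : ℂ)⁻¹ • ∑ j, q G i j • freeX G j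

/-- `e_i^* = |X|⁻¹ ∑_j q_i^*(j) x_j^*` in the free algebra. -/
def freeEDual (i : Fin (G.diam + 1)) : Free G :=
  (Fintype.card V : ℂ)⁻¹ • ∑ j, qDual G i j • freeXDual G j

/-- The defining relations of the generalized Terwilliger algebra. -/
inductive Rel : Free G → Free G → Prop
  | x_zero : Rel (freeX G 0) 1
  | xDual_zero : Rel (freeXDual G 0) 1
  | x_mul (i j : Fin (G.diam + 1)) :
      Rel (freeX G i * freeX G j) (∑ h, (intersectionNumber G h i j : ℂ) • freeX G h)
  | xDual_mul (i j : Fin (G.diam + 1)) :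
      Rel (freeXDual G i * freeXDual G j) (∑ h, kreinParameter G h i j • freeXDual G h)
  | triple (h i j : Fin (G.diam + 1)) (hp : intersectionNumber G h i j = 0) :
      Rel (freeEDual G h * freeX G i * freeEDual G j) 0
  | tripleDual (h i j : Fin (G.diam + 1)) (hp : kreinParameter G h i j = 0) :
      Rel (freeE G h * freeXDual G i * freeE G j) 0

/-- The generalized Terwilliger algebra associated with `G`. -/
abbrev GenTerwilliger : Type := RingQuot (Rel G)

/-- The element `e_i` of the generalized Terwilliger algebra. -/
def e (i : Fin (G.diam + 1)) : GenTerwilliger G := RingQuot.mkAlgHom ℂ (Rel G) (freeE G i)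

/-- The element `e_i^*` of the generalized Terwilliger algebra. -/
def eDual (i : Fin (G.diam + 1)) : GenTerwilliger G := RingQuot.mkAlgHom ℂ (Rel G) (freeEDual G i)

/-- The primary central idempotent `u_0 = |X| ∑_i k_i⁻¹ e_i^* e_0 e_i^*`. -/
def u₀ : GenTerwilliger G :=
  (Fintype.card V : ℂ) • ∑ i, (valency G i : ℂ)⁻¹ • (eDual G i * e G 0 * eDual G i)

/-- The dual expression `|X| ∑_i (k_i^*)⁻¹ e_i e_0^* e_i` for the primary central idempotent. -/
def u₀Dual : GenTerwilliger G :=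
  (Fintype.card V : ℂ) • ∑ i, (dualValency G i)⁻¹ • (e G i * eDual G 0 * e G i)

end Graph

/-- `𝒯_d`, the generalized Terwilliger algebra associated with the `d`-cube. -/
abbrev CubeAlgebra (d : ℕ) : Type := GenTerwilliger (hypercube d)

end

end Terwilliger

namespace Terwilliger

noncomputable section

open Matrix Finset

/-! ### Krawtchouk numbers -/

section Krawtchouk

open Polynomial

/-! The $d$-cube is self-dual: its scalars $q_i(j)$ and $q_i^*(j)$ are both the Krawtchouk numbers,
and its Krein parameters equal its intersection numbers. Hence $\mathcal T_d$ is the universal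
algebra containing two complete families of orthogonal idempotents, $e_i$ and $e_i^*$, subject to
the triple product relations (`CubePair`, `cubePair_cube`, `CubePair.exists_lift`), and every
identity in it has a dual one (`CubePair.swap`).

The triple products give $e_0e_h^*e_0=2^{-d}\binom dh e_0$, so $u_0$ fixes every $e_h^*e_0$, is
idempotent and commutes with every $e_h^*$. Since $e_h^*e_0$ is a combination of the $e_je_0^*e_0$,
the dual expression for $u_0$ fixes the same elements. This makes the two expressions equal
(`CubePair.primaryIdempotent_eq_dual`), and so $u_0$ commutes with every $e_h$ as well and is
central.

The ideal of $u_0$ lies in the span of the $(d+1)^2$ elements $e_h^*e_0e_j^*$, which the primary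
module sends to nonzero multiples of the matrix units (`primarySpanStabilizer_eq_top`,
`ofMatrix_map_of_mem_primarySpan`). This gives the factor $M_{d+1}(\mathbb C)$.

Modulo $u_0$ the elements $e_0,e_0^*$ vanish, and then so do $e_d,e_d^*$. From $(1-X)(1+X)=1-X^2$ it
follows that the remaining idempotents, with indices lowered by one, satisfy exactly the relations
of the $(d-2)$-cube (`CubePair.shiftUp`, `CubePair.shiftDown`). Thus $\mathcal
T_d/(u_0)\cong\mathcal T_{d-2}$ (`mul_primaryIdempotent_eq_self_of_map_eq_zero`). -/

/-- The Krawtchouk number: the coefficient of `X ^ i` in `(1 - X) ^ j * (1 + X) ^ (d - j)`. -/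
def krawtchouk (d i j : ℕ) : ℤ := ((1 - X : ℤ[X]) ^ j * (1 + X) ^ (d - j)).coeff i

lemma prod_add_mul_eq_sum_powersetCard {R : Type*} [CommRing R] {d : ℕ} (ε : Fin d → R) (a b : R) :
    ∏ m, (ε m * a + b) = ∑ l ∈ range (d + 1),
      (∑ S ∈ powersetCard l (univ : Finset (Fin d)), ∏ m ∈ S, ε m) * (a ^ l * b ^ (d - l)) := by
  rw [Finset.prod_add, Finset.sum_powerset]
  simp only [card_univ, Fintype.card_fin]
  refine sum_congr rfl fun l _ => ?_
  rw [sum_mul]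
  refine sum_congr rfl fun S hS => ?_
  rw [mem_powersetCard_univ] at hS
  rw [prod_mul_distrib, prod_const, prod_const, hS, card_sdiff_of_subset (subset_univ _), hS,
    card_univ, Fintype.card_fin, mul_assoc]

lemma prod_signs {R : Type*} [CommRing R] {d : ℕ} (L : Finset (Fin d)) (a b : R) :
    ∏ m, ((if m ∈ L then (-1 : R) else 1) * a + b) = (b - a) ^ #L * (b + a) ^ (d - #L) := by
  have h : ∀ m : Fin d, ((if m ∈ L then (-1 : R) else 1) * a + b) =
      if m ∈ L then b - a else b + a := by
    intro m; split_ifs <;> ring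
  simp only [h]
  rw [prod_ite, prod_const, prod_const, filter_mem_eq_inter, univ_inter]
  congr 2
  rw [filter_not, filter_mem_eq_inter, univ_inter, card_sdiff_of_subset (subset_univ _), card_univ,
    Fintype.card_fin]

/-- Both sides are the coefficient of $X^l$ in $\prod_m(1+\varepsilon_mX)$, with $\varepsilon_m=-1$
exactly on `L`. The combinatorial form links Krawtchouk numbers to characters of the cube. -/
lemma sum_powersetCard_signs {d : ℕ} (L : Finset (Fin d)) (l : ℕ) :
    ∑ S ∈ powersetCard l (univ : Finset (Fin d)), ∏ m ∈ S, (if m ∈ L then (-1 : ℤ) else 1) =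
      krawtchouk d l #L := by
  rcases le_or_gt l d with hl | hl
  · have h := prod_signs L (X : ℤ[X]) 1
    have h2 := prod_add_mul_eq_sum_powersetCard
      (fun m => C (if m ∈ L then (-1 : ℤ) else 1)) (X : ℤ[X]) 1
    have h3 : ∀ m : Fin d, (C (if m ∈ L then (-1 : ℤ) else 1) : ℤ[X]) =
        if m ∈ L then -1 else 1 := by
      intro m; split_ifs <;> simp
    simp only [h3] at h2
    rw [h] at h2
    rw [krawtchouk, add_comm 1 X, add_comm X 1, h2, finsetSum_coeff,
      sum_eq_single_of_mem l (by simpa using Nat.lt_succ_of_le hl)]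
    · simp only [← h3, ← map_prod, ← map_sum]
      rw [one_pow, mul_one, coeff_C_mul_X_pow, if_pos rfl]
    · intro b _ hb
      simp only [← h3, ← map_prod, ← map_sum]
      rw [one_pow, mul_one, coeff_C_mul_X_pow, if_neg hb.symm]
  · rw [powersetCard_eq_empty.2 (by simpa using hl), sum_empty, krawtchouk,
      coeff_eq_zero_of_natDegree_lt]
    have hL : #L ≤ d := by simpa using card_le_univ L
    have h1 : (1 - X : ℤ[X]).natDegree ≤ 1 := by compute_degree
    have h2 : (1 + X : ℤ[X]).natDegree ≤ 1 := by compute_degree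
    calc _ ≤ #L * 1 + (d - #L) * 1 :=
          natDegree_mul_le_of_le (natDegree_pow_le_of_le _ h1) (natDegree_pow_le_of_le _ h2)
      _ < l := by omega

lemma exists_card_fin {d j : ℕ} (hj : j ≤ d) : ∃ L : Finset (Fin d), #L = j := by
  obtain ⟨L, -, hL⟩ := exists_subset_card_eq (s := (univ : Finset (Fin d))) (by simpa using hj)
  exact ⟨L, hL⟩

lemma krawtchouk_eq_zero {d i j : ℕ} (hj : j ≤ d) (hi : d < i) : krawtchouk d i j = 0 := by
  obtain ⟨L, rfl⟩ := exists_card_fin hj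
  rw [← sum_powersetCard_signs, powersetCard_eq_empty.2 (by simpa using hi), sum_empty]

lemma sum_krawtchouk_mul_pow {R : Type*} [CommRing R] {d j : ℕ} (hj : j ≤ d) (a b : R) :
    ∑ l ∈ range (d + 1), (krawtchouk d l j : R) * (a ^ l * b ^ (d - l)) =
      (b - a) ^ j * (b + a) ^ (d - j) := by
  obtain ⟨L, rfl⟩ := exists_card_fin hj
  rw [← prod_signs, prod_add_mul_eq_sum_powersetCard]
  refine sum_congr rfl fun l _ => ?_
  rw [← sum_powersetCard_signs]
  push_cast
  rfl

/-- Substituting $a=1-X$, $b=1+X$ in the generating function gives $b-a=2X$ and $b+a=2$, so the sum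
is the coefficient of $X^i$ in $2^dX^j$. The Krawtchouk matrix is thus its own inverse up to $2^d$;
every inversion below rests on this. -/
lemma sum_krawtchouk_mul_krawtchouk {d j : ℕ} (i : ℕ) (hj : j ≤ d) :
    ∑ l ∈ range (d + 1), krawtchouk d i l * krawtchouk d l j = if i = j then 2 ^ d else 0 := by
  have h := congrArg (fun p => coeff p i) (sum_krawtchouk_mul_pow hj (1 - X : ℤ[X]) (1 + X))
  have h2 : ((1 + X - (1 - X)) ^ j * (1 + X + (1 - X)) ^ (d - j) : ℤ[X]) = C (2 ^ d) * X ^ j := by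
    have : ((1 + X + (1 - X) : ℤ[X])) = C 2 := by rw [show (C 2 : ℤ[X]) = 2 from rfl]; ring
    rw [this]
    have : ((1 + X - (1 - X) : ℤ[X])) = C 2 * X := by rw [show (C 2 : ℤ[X]) = 2 from rfl]; ring
    rw [this, mul_pow, ← C_pow, ← C_pow, mul_right_comm, ← C_mul, ← pow_add, Nat.add_sub_cancel' hj]
  simp only [h2, finsetSum_coeff, coeff_C_mul, coeff_X_pow] at h
  rw [mul_ite, mul_one, mul_zero] at h
  rw [← h]
  refine sum_congr rfl fun l _ => ?_
  rw [← C_eq_intCast, coeff_C_mul, mul_comm]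
  rfl

lemma krawtchouk_zero_left (d j : ℕ) : krawtchouk d 0 j = 1 := by
  simp [krawtchouk, coeff_zero_eq_eval_zero]

lemma krawtchouk_zero_right (d i : ℕ) : krawtchouk d i 0 = d.choose i := by
  simp [krawtchouk, add_comm 1 X, coeff_X_add_one_pow]

lemma krawtchouk_self_left {d j : ℕ} (hj : j ≤ d) : krawtchouk d d j = (-1) ^ j := by
  obtain ⟨L, rfl⟩ := exists_card_fin hj
  rw [← sum_powersetCard_signs]
  have : powersetCard d (univ : Finset (Fin d)) = {univ} := by
    have := powersetCard_self (univ : Finset (Fin d))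
    rwa [card_univ, Fintype.card_fin] at this
  rw [this, sum_singleton, prod_ite, prod_const_one, mul_one, prod_const, filter_mem_eq_inter,
    univ_inter]

lemma krawtchouk_one_left {d j : ℕ} (hj : j ≤ d) : krawtchouk d 1 j = d - 2 * j := by
  obtain ⟨L, rfl⟩ := exists_card_fin hj
  rw [← sum_powersetCard_signs, powersetCard_one, sum_map]
  simp only [Function.Embedding.coeFn_mk, prod_singleton]
  simp [sum_ite, filter_not, card_sdiff_of_subset, Nat.cast_sub hj]
  ring

/-- Raising $d$ by two and $l$ by one multiplies the generating function by $(1-X)(1+X)=1-X^2$. This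
identity drives the passage between $\mathcal T_{d+2}$ and $\mathcal T_d$. -/
lemma krawtchouk_add_two (d i l : ℕ) (hl : l ≤ d) :
    krawtchouk (d + 2) (i + 2) (l + 1) = krawtchouk d (i + 2) l - krawtchouk d i l := by
  have h : ((1 - X) ^ (l + 1) * (1 + X) ^ (d + 2 - (l + 1)) : ℤ[X]) =
      (1 - X) ^ l * (1 + X) ^ (d - l) - (1 - X) ^ l * (1 + X) ^ (d - l) * X ^ 2 := by
    rw [show d + 2 - (l + 1) = d - l + 1 by omega]
    ring
  rw [krawtchouk, h, coeff_sub, coeff_mul_X_pow]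
  rfl

lemma krawtchouk_add_two_of_lt {d i l : ℕ} (hl : l ≤ d) (hi : i < 2) :
    krawtchouk (d + 2) i (l + 1) = krawtchouk d i l := by
  have h : ((1 - X) ^ (l + 1) * (1 + X) ^ (d + 2 - (l + 1)) : ℤ[X]) =
      (1 - X) ^ l * (1 + X) ^ (d - l) - (1 - X) ^ l * (1 + X) ^ (d - l) * X ^ 2 := by
    rw [show d + 2 - (l + 1) = d - l + 1 by omega]
    ring
  rw [krawtchouk, h, coeff_sub, coeff_mul_X_pow', if_neg (by omega), sub_zero]
  rfl

end Krawtchouk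

/-! ### Distances in the cube -/

lemma hypercube_adj {d : ℕ} {x y : Fin d → ℤˣ} : (hypercube d).Adj x y ↔ hammingDist x y = 1 := by
  rw [hammingDist, card_eq_one]
  simp only [hypercube, ExistsUnique, Finset.ext_iff, mem_filter, mem_univ, true_and,
    mem_singleton]
  constructor
  · rintro ⟨i, hi, h⟩
    exact ⟨i, fun a => ⟨h a, fun ha => ha ▸ hi⟩⟩
  · rintro ⟨i, h⟩
    exact ⟨i, (h i).2 rfl, fun a => (h a).1⟩

lemma hammingDist_le_length {d : ℕ} {x y : Fin d → ℤˣ} (p : (hypercube d).Walk x y) :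
    hammingDist x y ≤ p.length := by
  induction p with
  | nil => simp
  | @cons u v w h p ih =>
    rw [SimpleGraph.Walk.length_cons]
    have := hypercube_adj.1 h
    have := hammingDist_triangle u v w
    omega

lemma exists_walk_length_eq_hammingDist {d : ℕ} (n : ℕ) :
    ∀ x y : Fin d → ℤˣ, hammingDist x y = n → ∃ p : (hypercube d).Walk x y, p.length = n := by
  induction n with
  | zero =>
    intro x y h
    obtain rfl := hammingDist_eq_zero.1 h
    exact ⟨.nil, rfl⟩
  | succ n ih =>
    intro x y h
    obtain ⟨i, hi⟩ : ∃ i, x i ≠ y i := by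
      by_contra! hc
      rw [funext hc, hammingDist_self] at h
      omega
    have h1 : hammingDist x (Function.update x i (y i)) = 1 := by
      rw [hammingDist, card_eq_one]
      refine ⟨i, ?_⟩
      ext a
      by_cases ha : a = i
      · subst ha; simpa using hi
      · simp [ha]
    have h2 : hammingDist (Function.update x i (y i)) y = n := by
      have : (univ.filter fun a => Function.update x i (y i) a ≠ y a) =
          (univ.filter fun a => x a ≠ y a).erase i := by
        ext a
        by_cases ha : a = i
        · subst ha; simp
        · simp [ha]
      rw [hammingDist, this, card_erase_of_mem (by simpa using hi)]
      rw [hammingDist] at h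
      omega
    obtain ⟨p, hp⟩ := ih _ _ h2
    exact ⟨.cons (hypercube_adj.2 h1) p, by simp [hp]⟩

lemma hypercube_reachable {d : ℕ} (x y : Fin d → ℤˣ) : (hypercube d).Reachable x y :=
  (exists_walk_length_eq_hammingDist _ x y rfl).elim fun p _ => ⟨p⟩

lemma hypercube_dist {d : ℕ} (x y : Fin d → ℤˣ) : (hypercube d).dist x y = hammingDist x y := by
  apply le_antisymm
  · obtain ⟨p, hp⟩ := exists_walk_length_eq_hammingDist _ x y rfl
    exact hp ▸ SimpleGraph.dist_le p
  · obtain ⟨p, hp⟩ := (hypercube_reachable x y).exists_walk_length_eq_dist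
    exact hp ▸ hammingDist_le_length p

/-- The vertex obtained from `x` by changing the coordinates in `S`. -/
def flipOn {d : ℕ} (S : Finset (Fin d)) (x : Fin d → ℤˣ) : Fin d → ℤˣ :=
  fun i => if i ∈ S then -x i else x i

lemma filter_ne_flipOn {d : ℕ} (S : Finset (Fin d)) (x : Fin d → ℤˣ) :
    (univ.filter fun i => x i ≠ flipOn S x i) = S := by
  ext i
  by_cases hi : i ∈ S <;> simp [flipOn, hi]

lemma hammingDist_flipOn {d : ℕ} (S : Finset (Fin d)) (x : Fin d → ℤˣ) :
    hammingDist x (flipOn S x) = #S := by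
  rw [hammingDist, filter_ne_flipOn]

lemma hammingDist_le {d : ℕ} (x y : Fin d → ℤˣ) : hammingDist x y ≤ d := by
  simpa using hammingDist_le_card_fintype (x := x) (y := y)

lemma exists_hammingDist_eq {d h : ℕ} (x : Fin d → ℤˣ) (hh : h ≤ d) : ∃ y, hammingDist x y = h := by
  obtain ⟨S, hS⟩ := exists_card_fin hh
  exact ⟨flipOn S x, by rw [hammingDist_flipOn, hS]⟩

lemma hypercube_diam (d : ℕ) : (hypercube d).diam = d := by
  apply le_antisymm
  · obtain ⟨x, y, h⟩ := (hypercube d).exists_dist_eq_diam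
    rw [← h, hypercube_dist]
    exact hammingDist_le x y
  · obtain ⟨y, hy⟩ := exists_hammingDist_eq (fun _ : Fin d => (1 : ℤˣ)) le_rfl
    have hc : (hypercube d).Connected := ⟨hypercube_reachable⟩
    have := SimpleGraph.dist_le_diam (SimpleGraph.connected_iff_ediam_ne_top.1 hc)
      (u := fun _ : Fin d => (1 : ℤˣ)) (v := y)
    rwa [hypercube_dist, hy] at this

/-- The triples `(h, i, j)` for which the intersection number `p^h_{ij}` of the `d`-cube does not
vanish. -/
def Admissible (d h i j : ℕ) : Prop :=
  Even (h + i + j) ∧ h ≤ i + j ∧ i ≤ h + j ∧ j ≤ h + i ∧ h + i + j ≤ 2 * d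

lemma units_ne_iff {a b c : ℤˣ} : b ≠ c ↔ ¬ (a ≠ b ↔ a ≠ c) := by
  rcases Int.units_eq_one_or a with rfl | rfl <;> rcases Int.units_eq_one_or b with rfl | rfl <;>
    rcases Int.units_eq_one_or c with rfl | rfl <;> decide

/-- Coordinates take two values, so at each of them either none or exactly two of the three pairs
differ. This yields both the parity and the bound $2d$. -/
lemma admissible_hammingDist {d : ℕ} (x y z : Fin d → ℤˣ) :
    Admissible d (hammingDist x y) (hammingDist x z) (hammingDist y z) := by
  have key : hammingDist x y + hammingDist x z =
      hammingDist y z + 2 * #(univ.filter fun i => x i ≠ y i ∧ x i ≠ z i) := by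
    simp only [hammingDist, card_filter, ← sum_add_distrib, mul_sum]
    refine sum_congr rfl fun i _ => ?_
    have := units_ne_iff (a := x i) (b := y i) (c := z i)
    by_cases h1 : x i = y i <;> by_cases h2 : x i = z i <;> by_cases h3 : y i = z i <;>
      simp_all
  have key2 : hammingDist x y + hammingDist x z + hammingDist y z ≤ 2 * d := by
    have : 2 * d = ∑ i : Fin d, 2 := by simp [mul_comm]
    rw [this]
    simp only [hammingDist, card_filter, ← sum_add_distrib]
    refine sum_le_sum fun i _ => ?_
    have := units_ne_iff (a := x i) (b := y i) (c := z i)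
    by_cases h1 : x i = y i <;> by_cases h2 : x i = z i <;> by_cases h3 : y i = z i <;>
      simp_all
  refine ⟨⟨hammingDist y z + #(univ.filter fun i => x i ≠ y i ∧ x i ≠ z i), by omega⟩, ?_, ?_, ?_,
    key2⟩
  · exact hammingDist_comm z y ▸ hammingDist_triangle x z y
  · exact hammingDist_triangle x y z
  · exact hammingDist_comm y x ▸ hammingDist_triangle y x z

lemma exists_of_admissible {d i j : ℕ} (x y : Fin d → ℤˣ) (h : Admissible d (hammingDist x y) i j) :
    ∃ z, hammingDist x z = i ∧ hammingDist y z = j := by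
  obtain ⟨⟨c, hc⟩, h1, h2, h3, h4⟩ := h
  set D := univ.filter fun m => x m ≠ y m with hD
  have hDc : #D = hammingDist x y := rfl
  have hDd := hammingDist_le x y
  -- The vertex `z` is obtained by flipping `x` on `A`, inside the set where `x` and `y` differ, and
  -- on `B`, outside it. The equations $|A|+|B|=i$ and $|D|-|A|+|B|=j$ force these two sizes, where
  -- $2c$ is the sum of the three distances.
  obtain ⟨A, hA, hAc⟩ := exists_subset_card_eq (s := D) (n := c - j) (by omega)
  obtain ⟨B, hB, hBc⟩ := exists_subset_card_eq (s := Dᶜ) (n := c - hammingDist x y)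
    (by rw [card_compl, Fintype.card_fin]; omega)
  have hdisj : Disjoint A B := disjoint_of_subset_left hA
    (disjoint_of_subset_right hB disjoint_compl_right)
  have hx : hammingDist x (flipOn (A ∪ B) x) = i := by
    rw [hammingDist_flipOn, card_union_of_disjoint hdisj]; omega
  refine ⟨flipOn (A ∪ B) x, hx, ?_⟩
  have : (univ.filter fun m => y m ≠ flipOn (A ∪ B) x m) = (D \ A) ∪ B := by
    ext m
    have h5 : m ∈ D ↔ x m ≠ y m := by simp [hD]
    have h6 : m ∈ A ∪ B ↔ x m ≠ flipOn (A ∪ B) x m := by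
      have := filter_ne_flipOn (A ∪ B) x
      rw [Finset.ext_iff] at this
      simpa using (this m).symm
    have h7 := units_ne_iff (a := x m) (b := y m) (c := flipOn (A ∪ B) x m)
    have h8 : m ∈ A → m ∈ D := fun h => hA h
    have h9 : m ∈ B → m ∉ D := fun h => mem_compl.1 (hB h)
    rw [mem_filter, h7, ← h5, ← h6]
    simp only [mem_union, mem_sdiff, mem_univ, true_and]
    tauto
  rw [hammingDist, this, card_union_of_disjoint, card_sdiff_of_subset hA]
  · omega
  · exact disjoint_of_subset_left sdiff_subset (disjoint_of_subset_right hB disjoint_compl_right)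

/-! ### The primitive idempotents of the cube -/

/-- The character of `{-1, 1}^d` associated with a set of coordinates. -/
def cubeChar {d : ℕ} (S : Finset (Fin d)) (x : Fin d → ℤˣ) : ℤ := ∏ m ∈ S, (x m : ℤ)

lemma krawtchouk_hammingDist {d : ℕ} (l : ℕ) (x y : Fin d → ℤˣ) :
    krawtchouk d l (hammingDist x y) =
      ∑ S ∈ powersetCard l univ, cubeChar S x * cubeChar S y := by
  rw [hammingDist, ← sum_powersetCard_signs]
  refine sum_congr rfl fun S _ => ?_
  rw [cubeChar, cubeChar, ← prod_mul_distrib]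
  refine prod_congr rfl fun m _ => ?_
  rcases Int.units_eq_one_or (x m) with h | h <;> rcases Int.units_eq_one_or (y m) with h' | h' <;>
    simp [h, h']

/-- The sum factors over coordinates; a coordinate lying in exactly one of `S` and `T` contributes
$1+(-1)=0$. -/
lemma sum_cubeChar_mul_cubeChar {d : ℕ} (S T : Finset (Fin d)) :
    ∑ z, cubeChar S z * cubeChar T z = if S = T then 2 ^ d else 0 := by
  have h : ∀ z : Fin d → ℤˣ, cubeChar S z * cubeChar T z =
      ∏ m, ((if m ∈ S then (z m : ℤ) else 1) * (if m ∈ T then (z m : ℤ) else 1)) := by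
    intro z
    rw [prod_mul_distrib, prod_ite_mem, prod_ite_mem, univ_inter, univ_inter, cubeChar, cubeChar]
  have h2 := (prod_univ_sum (fun _ : Fin d => (univ : Finset ℤˣ)) (fun m (e : ℤˣ) =>
    ((if m ∈ S then (e : ℤ) else 1) * (if m ∈ T then (e : ℤ) else 1)))).symm
  rw [Fintype.piFinset_univ] at h2
  rw [sum_congr rfl fun z _ => h z, h2]
  have h3 : ∀ m : Fin d, ∑ e : ℤˣ,
      ((if m ∈ S then (e : ℤ) else 1) * (if m ∈ T then (e : ℤ) else 1)) =
        if (m ∈ S ↔ m ∈ T) then 2 else 0 := by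
    intro m
    rw [show (univ : Finset ℤˣ) = {1, -1} from rfl, sum_pair (by decide)]
    by_cases h1 : m ∈ S <;> by_cases h2 : m ∈ T <;> simp [h1, h2]
  rw [prod_congr rfl fun m _ => h3 m]
  split_ifs with hST
  · subst hST; simp
  · obtain ⟨m, hm⟩ : ∃ m, ¬ (m ∈ S ↔ m ∈ T) := by
      by_contra! hc
      exact hST (Finset.ext hc)
    exact prod_eq_zero (mem_univ m) (if_neg hm)

section Field

variable (F : Type*) [Field F]

/-- The orthogonal projection onto the span of the characters of weight `l`. -/
def cubeIdempotent (d l : ℕ) : Matrix (Fin d → ℤˣ) (Fin d → ℤˣ) F :=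
  Matrix.of fun x y => (2 ^ d)⁻¹ * (krawtchouk d l (hammingDist x y) : F)

lemma sum_krawtchouk_hammingDist {d : ℕ} (l m : ℕ) (x y : Fin d → ℤˣ) :
    ∑ z, krawtchouk d l (hammingDist x z) * krawtchouk d m (hammingDist z y) =
      if l = m then 2 ^ d * krawtchouk d l (hammingDist x y) else 0 := by
  have h : ∀ z, krawtchouk d l (hammingDist x z) * krawtchouk d m (hammingDist z y) =
      ∑ S ∈ powersetCard l univ, ∑ T ∈ powersetCard m univ,
        cubeChar S x * cubeChar T y * (cubeChar S z * cubeChar T z) := by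
    intro z
    rw [krawtchouk_hammingDist, krawtchouk_hammingDist, sum_mul_sum]
    exact sum_congr rfl fun S _ => sum_congr rfl fun T _ => by ring
  rw [sum_congr rfl fun z _ => h z, sum_comm]
  simp_rw [sum_comm (s := univ), ← mul_sum, sum_cubeChar_mul_cubeChar]
  split_ifs with hlm
  · subst hlm
    rw [krawtchouk_hammingDist, mul_sum]
    refine sum_congr rfl fun S hS => ?_
    rw [sum_eq_single_of_mem S hS (fun T _ hT => by rw [if_neg hT.symm, mul_zero]), if_pos rfl]
    ring
  · refine sum_eq_zero fun S hS => sum_eq_zero fun T hT => ?_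
    rw [if_neg, mul_zero]
    rintro rfl
    rw [mem_powersetCard_univ] at hS hT
    omega

variable [CharZero F]

lemma cubeIdempotent_mul (d l m : ℕ) : cubeIdempotent F d l * cubeIdempotent F d m =
    if l = m then cubeIdempotent F d l else 0 := by
  ext x y
  have h := congrArg (Int.cast : ℤ → F) (sum_krawtchouk_hammingDist l m x y)
  push_cast at h
  have h0 : (2 : F) ^ d ≠ 0 := pow_ne_zero _ two_ne_zero
  simp only [mul_apply, cubeIdempotent, of_apply]
  simp_rw [mul_mul_mul_comm, ← mul_sum, h]
  split_ifs with hlm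
  · simp only [of_apply]; field_simp
  · simp

/-- This inverts the definition of `cubeIdempotent` by means of the squared Krawtchouk matrix. The
case $i=0$ resolves the identity and $i=1$ diagonalizes the adjacency matrix. -/
lemma distance_eq_sum_cubeIdempotent (d i : ℕ) :
    (Matrix.of fun x y => if hammingDist x y = i then 1 else 0 :
      Matrix (Fin d → ℤˣ) (Fin d → ℤˣ) F) =
      ∑ l ∈ range (d + 1), (krawtchouk d i l : F) • cubeIdempotent F d l := by
  ext x y
  have h := congrArg (Int.cast : ℤ → F) (sum_krawtchouk_mul_krawtchouk i (hammingDist_le x y))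
  push_cast at h
  have h0 : (2 : F) ^ d ≠ 0 := pow_ne_zero _ two_ne_zero
  simp only [cubeIdempotent, Matrix.sum_apply, Matrix.smul_apply, of_apply, smul_eq_mul]
  simp_rw [mul_left_comm, ← mul_sum, h, eq_comm (a := i)]
  split_ifs <;> simp

lemma sum_cubeIdempotent (d : ℕ) : ∑ l ∈ range (d + 1), cubeIdempotent F d l = 1 := by
  have h := distance_eq_sum_cubeIdempotent F d 0
  simp only [krawtchouk_zero_left, Int.cast_one, one_smul] at h
  rw [← h]
  ext x y
  simp [one_apply]

open scoped Classical in
lemma adjMatrix_hypercube (d : ℕ) : (hypercube d).adjMatrix F =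
    ∑ l ∈ range (d + 1), ((d : F) - 2 * l) • cubeIdempotent F d l := by
  have h := distance_eq_sum_cubeIdempotent F d 1
  have h2 : ∀ l ∈ range (d + 1), (krawtchouk d 1 l : F) • cubeIdempotent F d l =
      ((d : F) - 2 * l) • cubeIdempotent F d l := by
    intro l hl
    rw [krawtchouk_one_left (by rw [mem_range] at hl; omega)]
    push_cast
    rfl
  rw [sum_congr rfl h2] at h
  rw [← h]
  ext x y
  simp [SimpleGraph.adjMatrix_apply, hypercube_adj]

open scoped Classical in
lemma adjMatrix_mul_cubeIdempotent {d l : ℕ} (hl : l ≤ d) :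
    (hypercube d).adjMatrix F * cubeIdempotent F d l =
      ((d : F) - 2 * l) • cubeIdempotent F d l := by
  rw [adjMatrix_hypercube, sum_mul, sum_eq_single_of_mem l (by rw [mem_range]; omega)]
  · rw [smul_mul_assoc, cubeIdempotent_mul, if_pos rfl]
  · intro m _ hm
    rw [smul_mul_assoc, cubeIdempotent_mul, if_neg hm, smul_zero]

open scoped Classical in
lemma cubeIdempotent_mul_adjMatrix {d l : ℕ} (hl : l ≤ d) :
    cubeIdempotent F d l * (hypercube d).adjMatrix F =
      ((d : F) - 2 * l) • cubeIdempotent F d l := by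
  rw [adjMatrix_hypercube, mul_sum, sum_eq_single_of_mem l (by rw [mem_range]; omega)]
  · rw [mul_smul_comm, cubeIdempotent_mul, if_pos rfl]
  · intro m _ hm
    rw [mul_smul_comm, cubeIdempotent_mul, if_neg hm.symm, smul_zero]

lemma cubeIdempotent_ne_zero {d l : ℕ} (hl : l ≤ d) : cubeIdempotent F d l ≠ 0 := by
  intro h
  have h1 := congrFun (congrFun h 1) 1
  have h0 : (2 : F) ^ d ≠ 0 := pow_ne_zero _ two_ne_zero
  have h2 : (d.choose l : F) ≠ 0 := by exact_mod_cast (Nat.choose_pos hl).ne'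
  simp [cubeIdempotent, krawtchouk_zero_right, h2] at h1

variable {F} in
open scoped Classical in
lemma cubeIdempotent_mulVec_of_eigenvector {d l : ℕ} (hl : l ≤ d) {μ : F} {v : (Fin d → ℤˣ) → F}
    (hv : (hypercube d).adjMatrix F *ᵥ v = μ • v) (hμ : μ ≠ (d : F) - 2 * l) :
    cubeIdempotent F d l *ᵥ v = 0 := by
  have h := congrArg (cubeIdempotent F d l *ᵥ ·) hv
  simp only [mulVec_mulVec, cubeIdempotent_mul_adjMatrix F hl, mulVec_smul, smul_mulVec] at h
  rw [← sub_eq_zero, ← sub_smul, smul_eq_zero, sub_eq_zero] at h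
  exact h.resolve_left hμ.symm

variable {F} in
lemma sum_cubeIdempotent_mulVec {d : ℕ} (v : (Fin d → ℤˣ) → F) :
    ∑ l ∈ range (d + 1), cubeIdempotent F d l *ᵥ v = v := by
  rw [← sum_mulVec, sum_cubeIdempotent, one_mulVec]

open scoped Classical in
lemma mem_spectrum_hypercube {d : ℕ} {μ : F} :
    μ ∈ spectrum F ((hypercube d).adjMatrix F) ↔ ∃ l ≤ d, (d : F) - 2 * l = μ := by
  rw [← spectrum_toLin', ← Module.End.hasEigenvalue_iff_mem_spectrum]
  constructor
  · intro h
    obtain ⟨v, hv⟩ := h.exists_hasEigenvector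
    by_contra! hc
    apply hv.2
    rw [← sum_cubeIdempotent_mulVec v]
    refine sum_eq_zero fun l hl => ?_
    have hl' : l ≤ d := by rw [mem_range] at hl; omega
    exact cubeIdempotent_mulVec_of_eigenvector hl' (by simpa using hv.apply_eq_smul)
      (hc l hl').symm
  · rintro ⟨l, hl, rfl⟩
    obtain ⟨w, hw⟩ : ∃ w, cubeIdempotent F d l *ᵥ w ≠ 0 := by
      by_contra! hc
      exact cubeIdempotent_ne_zero F hl
        (Matrix.ext_of_mulVec_single fun i => by rw [hc, zero_mulVec])
    refine Module.End.hasEigenvalue_of_hasEigenvector (x := cubeIdempotent F d l *ᵥ w) ⟨?_, hw⟩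
    rw [Module.End.mem_eigenspace_iff, toLin'_apply, mulVec_mulVec,
      adjMatrix_mul_cubeIdempotent F hl, smul_mulVec]

end Field

/-! ### The chosen eigenvalues and idempotents are the explicit ones -/

section Epsilon

variable {V : Type*} [Fintype V] {G : SimpleGraph V} [DecidableRel G.Adj]

lemma eigenvalue_eq [DecidableEq V] {θ : Fin (G.diam + 1) → ℝ} (h1 : StrictAnti θ)
    (h2 : Set.range θ = spectrum ℝ (G.adjMatrix ℝ)) : eigenvalue G = θ := by
  classical
  have h : StrictAnti (eigenvalue G) ∧ Set.range (eigenvalue G) = spectrum ℝ (G.adjMatrix ℝ) := by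
    convert Classical.epsilon_spec (p := fun θ : Fin (G.diam + 1) → ℝ =>
      StrictAnti θ ∧ Set.range θ = spectrum ℝ (G.adjMatrix ℝ)) ⟨θ, h1, h2⟩ <;>
    · rw [eigenvalue]
      congr!
  exact (StrictAnti.range_inj h.1 h1).1 (h.2.trans h2.symm)

lemma primitiveIdempotent_spec {i : Fin (G.diam + 1)} {E : Matrix V V ℂ}
    (h1 : ∀ v : V → ℂ, G.adjMatrix ℂ *ᵥ v = (eigenvalue G i : ℂ) • v → E *ᵥ v = v)
    (h2 : ∀ μ : ℂ, μ ≠ (eigenvalue G i : ℂ) → ∀ v : V → ℂ, G.adjMatrix ℂ *ᵥ v = μ • v →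
      E *ᵥ v = 0) :
    (∀ v : V → ℂ, G.adjMatrix ℂ *ᵥ v = (eigenvalue G i : ℂ) • v →
      primitiveIdempotent G i *ᵥ v = v) ∧
    (∀ μ : ℂ, μ ≠ (eigenvalue G i : ℂ) → ∀ v : V → ℂ, G.adjMatrix ℂ *ᵥ v = μ • v →
      primitiveIdempotent G i *ᵥ v = 0) := by
  convert Classical.epsilon_spec (p := fun E : Matrix V V ℂ =>
    (∀ v : V → ℂ, G.adjMatrix ℂ *ᵥ v = (eigenvalue G i : ℂ) • v → E *ᵥ v = v) ∧
    (∀ μ : ℂ, μ ≠ (eigenvalue G i : ℂ) →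
      ∀ v : V → ℂ, G.adjMatrix ℂ *ᵥ v = μ • v → E *ᵥ v = 0)) ⟨E, h1, h2⟩ <;>
  · rw [primitiveIdempotent]
    congr!

end Epsilon

section Fin

variable {d : ℕ}

lemma le_of_fin (i : Fin ((hypercube d).diam + 1)) : (i : ℕ) ≤ d := by
  have := i.2
  have := hypercube_diam d
  omega

lemma sum_fin_diam {M : Type*} [AddCommMonoid M] (f : ℕ → M) :
    ∑ i : Fin ((hypercube d).diam + 1), f i = ∑ i ∈ range (d + 1), f i := by
  rw [Fin.sum_univ_eq_sum_range, hypercube_diam]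

/-- The index `i` as an element of the index type of `hypercube d`. -/
def toFin {i : ℕ} (hi : i ≤ d) : Fin ((hypercube d).diam + 1) :=
  ⟨i, by rw [hypercube_diam]; omega⟩

lemma eigenvalue_hypercube (i : Fin ((hypercube d).diam + 1)) :
    eigenvalue (hypercube d) i = d - 2 * (i : ℕ) := by
  classical
  set θ : Fin ((hypercube d).diam + 1) → ℝ := fun i => d - 2 * (i : ℕ) with hθ
  have h1 : StrictAnti θ ∧ Set.range θ = spectrum ℝ ((hypercube d).adjMatrix ℝ) := by
    constructor
    · intro a b hab
      have : ((a : ℕ) : ℝ) < ((b : ℕ) : ℝ) := by exact_mod_cast hab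
      simp only [hθ]
      linarith
    · ext μ
      rw [mem_spectrum_hypercube]
      constructor
      · rintro ⟨i, rfl⟩
        exact ⟨i, le_of_fin i, rfl⟩
      · rintro ⟨l, hl, rfl⟩
        exact ⟨toFin hl, rfl⟩
  rw [eigenvalue_eq h1.1 h1.2]

lemma primitiveIdempotent_hypercube (i : Fin ((hypercube d).diam + 1)) :
    primitiveIdempotent (hypercube d) i = cubeIdempotent ℂ d i := by
  classical
  have hθ : ((eigenvalue (hypercube d) i : ℝ) : ℂ) = (d : ℂ) - 2 * (i : ℕ) := by
    rw [eigenvalue_hypercube]; push_cast; rfl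
  have hne : ∀ l : ℕ, l ≠ i → (d : ℂ) - 2 * (i : ℕ) ≠ (d : ℂ) - 2 * l := by
    intro l hl h
    apply hl
    have : (l : ℂ) = (i : ℕ) := by linear_combination (-1 / 2 : ℂ) * (-h)
    exact_mod_cast this
  have hE := primitiveIdempotent_spec (G := hypercube d) (i := i) (E := cubeIdempotent ℂ d i) (by
    rw [hθ]
    intro v hv
    conv_rhs => rw [← sum_cubeIdempotent_mulVec v]
    rw [sum_eq_single_of_mem (i : ℕ) (by have := le_of_fin i; rw [mem_range]; omega)]
    intro l hl hli
    rw [mem_range] at hl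
    exact cubeIdempotent_mulVec_of_eigenvector (by omega) hv (hne l hli)) (by
    rw [hθ]
    intro μ hμ v hv
    exact cubeIdempotent_mulVec_of_eigenvector (le_of_fin i) hv hμ)
  rw [hθ] at hE
  have hadj : ∀ l ≤ d, ∀ v, (hypercube d).adjMatrix ℂ *ᵥ (cubeIdempotent ℂ d l *ᵥ v) =
      ((d : ℂ) - 2 * l) • (cubeIdempotent ℂ d l *ᵥ v) := by
    intro l hl v
    rw [mulVec_mulVec, adjMatrix_mul_cubeIdempotent ℂ hl, smul_mulVec]
  -- Each basis vector is a sum of eigenvectors, on which the defining property of the primitive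
  -- idempotent prescribes its action.
  refine Matrix.ext_of_mulVec_single fun j => ?_
  conv_lhs => rw [← sum_cubeIdempotent_mulVec (Pi.single j (1 : ℂ)), mulVec_sum]
  rw [sum_eq_single_of_mem (i : ℕ) (by have := le_of_fin i; rw [mem_range]; omega)]
  · exact hE.1 _ (hadj _ (le_of_fin i) _)
  · intro l hl hli
    rw [mem_range] at hl
    exact hE.2 _ (hne l hli).symm _ (hadj l (by omega) _)

end Fin

/-! ### The parameters of the cube -/

/-- The intersection number `p^h_{ij}` of the `d`-cube in terms of Krawtchouk numbers. -/
def cubeParam (d h i j : ℕ) : ℂ :=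
  (2 ^ d)⁻¹ * ∑ m ∈ range (d + 1),
    (krawtchouk d i m : ℂ) * (krawtchouk d j m : ℂ) * (krawtchouk d m h : ℂ)

lemma sum_krawtchouk_mul_krawtchouk_cast {d j : ℕ} (i : ℕ) (hj : j ≤ d) :
    ∑ l ∈ range (d + 1), (krawtchouk d i l : ℂ) * (krawtchouk d l j : ℂ) =
      if i = j then 2 ^ d else 0 := by
  have h := congrArg (Int.cast : ℤ → ℂ) (sum_krawtchouk_mul_krawtchouk i hj)
  push_cast at h
  exact h

/-- Pointwise multiplication of Krawtchouk functions thus has the `cubeParam` as structure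
constants. Read on eigenvalues this gives the intersection numbers, and read on matrix entries the
Krein parameters. -/
lemma sum_cubeParam_mul_krawtchouk {d l : ℕ} (i j : ℕ) (hl : l ≤ d) :
    ∑ h ∈ range (d + 1), cubeParam d h i j * (krawtchouk d h l : ℂ) =
      (krawtchouk d i l : ℂ) * (krawtchouk d j l : ℂ) := by
  simp only [cubeParam, mul_assoc, sum_mul, ← mul_sum]
  rw [sum_comm]
  simp only [← mul_sum, sum_krawtchouk_mul_krawtchouk_cast _ hl]
  rw [sum_eq_single_of_mem l (by rw [mem_range]; omega) (fun m _ hm => by rw [if_neg hm]; ring),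
    if_pos rfl]
  field_simp

lemma card_eq_cubeParam {d : ℕ} (x y : Fin d → ℤˣ) (i j : ℕ) :
    (Nat.card {z : Fin d → ℤˣ // hammingDist x z = i ∧ hammingDist y z = j} : ℂ) =
      cubeParam d (hammingDist x y) i j := by
  have h1 : (Nat.card {z : Fin d → ℤˣ // hammingDist x z = i ∧ hammingDist y z = j} : ℂ) =
      ((Matrix.of fun x y => if hammingDist x y = i then 1 else 0 :
        Matrix (Fin d → ℤˣ) (Fin d → ℤˣ) ℂ) *
       (Matrix.of fun x y => if hammingDist x y = j then 1 else 0 :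
        Matrix (Fin d → ℤˣ) (Fin d → ℤˣ) ℂ)) x y := by
    rw [Nat.card_eq_fintype_card, Fintype.card_subtype, card_filter, mul_apply]
    push_cast
    refine sum_congr rfl fun z _ => ?_
    simp only [of_apply, hammingDist_comm z y, ite_and, mul_ite, mul_one, mul_zero]
    split_ifs <;> rfl
  have h2 : ((Matrix.of fun x y => if hammingDist x y = i then 1 else 0 :
        Matrix (Fin d → ℤˣ) (Fin d → ℤˣ) ℂ) *
       (Matrix.of fun x y => if hammingDist x y = j then 1 else 0 :
        Matrix (Fin d → ℤˣ) (Fin d → ℤˣ) ℂ)) =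
      ∑ m ∈ range (d + 1), ((krawtchouk d i m : ℂ) * (krawtchouk d j m : ℂ)) •
        cubeIdempotent ℂ d m := by
    rw [distance_eq_sum_cubeIdempotent, distance_eq_sum_cubeIdempotent, sum_mul_sum]
    refine sum_congr rfl fun m hm => ?_
    rw [sum_eq_single_of_mem m hm]
    · rw [smul_mul_smul_comm, cubeIdempotent_mul, if_pos rfl]
    · intro n _ hn
      rw [smul_mul_smul_comm, cubeIdempotent_mul, if_neg hn.symm, smul_zero]
  rw [h1, h2, cubeParam, mul_sum, Matrix.sum_apply]
  refine sum_congr rfl fun m _ => ?_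
  simp only [cubeIdempotent, Matrix.smul_apply, of_apply, smul_eq_mul]
  ring

section Fin

variable {d : ℕ}

/-- The count depends on the two vertices only through their distance, by `card_eq_cubeParam`, so
the chosen number is the actual count. -/
lemma intersectionNumber_spec (h i j : Fin ((hypercube d).diam + 1)) {x y : Fin d → ℤˣ}
    (hxy : hammingDist x y = h) : intersectionNumber (hypercube d) h i j =
      Nat.card {z : Fin d → ℤˣ // hammingDist x z = i ∧ hammingDist y z = j} := by
  have hs := Classical.epsilon_spec (p := fun n : ℕ => ∀ x y : Fin d → ℤˣ,
    (hypercube d).dist x y = h → Nat.card {z : Fin d → ℤˣ //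
      (hypercube d).dist x z = i ∧ (hypercube d).dist y z = j} = n)
    ⟨Nat.card {z : Fin d → ℤˣ // hammingDist x z = i ∧ hammingDist y z = j}, by
      intro x' y' hx'
      simp only [hypercube_dist] at hx' ⊢
      have h1 := card_eq_cubeParam x y i j
      have h2 := card_eq_cubeParam x' y' i j
      rw [hx'] at h2
      rw [hxy, ← h2] at h1
      exact_mod_cast h1.symm⟩
  have := hs x y (by rw [hypercube_dist, hxy])
  simp only [hypercube_dist] at this
  rw [this, intersectionNumber]
  simp only [hypercube_dist]

lemma intersectionNumber_hypercube (h i j : Fin ((hypercube d).diam + 1)) :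
    (intersectionNumber (hypercube d) h i j : ℂ) = cubeParam d h i j := by
  obtain ⟨y, hy⟩ := exists_hammingDist_eq (fun _ : Fin d => (1 : ℤˣ)) (le_of_fin h)
  rw [intersectionNumber_spec h i j hy, card_eq_cubeParam, hy]

lemma intersectionNumber_eq_zero_iff (h i j : Fin ((hypercube d).diam + 1)) :
    intersectionNumber (hypercube d) h i j = 0 ↔ ¬ Admissible d h i j := by
  obtain ⟨y, hy⟩ := exists_hammingDist_eq (fun _ : Fin d => (1 : ℤˣ)) (le_of_fin h)
  rw [intersectionNumber_spec h i j hy, Finite.card_eq_zero_iff, isEmpty_subtype, ← hy,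
    iff_not_comm, not_forall]
  simp only [not_not]
  constructor
  · exact exists_of_admissible _ y
  · rintro ⟨z, h1, h2⟩
    exact h1 ▸ h2 ▸ admissible_hammingDist _ y z

lemma valency_hypercube (i : Fin ((hypercube d).diam + 1)) :
    valency (hypercube d) i = d.choose i := by
  have h0 : hammingDist (1 : Fin d → ℤˣ) 1 = (0 : Fin ((hypercube d).diam + 1)) := by simp
  rw [valency, intersectionNumber_spec _ _ _ h0]
  -- Multiplying by $E_0$, whose entries are all $2^{-d}$, turns the distance matrix into its row
  -- sums.
  have h := congrArg (· * cubeIdempotent ℂ d 0) (distance_eq_sum_cubeIdempotent ℂ d i)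
  simp only [sum_mul, smul_mul_assoc, cubeIdempotent_mul] at h
  rw [sum_eq_single_of_mem 0 (by simp) (fun l _ hl => by rw [if_neg hl, smul_zero]),
    if_pos rfl] at h
  have h1 := congrFun (congrFun h 1) 1
  simp only [mul_apply, cubeIdempotent, of_apply, krawtchouk_zero_left, Matrix.smul_apply,
    krawtchouk_zero_right, ← sum_mul, smul_eq_mul] at h1
  have h2 := mul_right_cancel₀ (by simp) h1
  rw [Nat.card_eq_fintype_card, Fintype.card_subtype]
  rw [sum_boole] at h2
  simp only [and_self]
  exact_mod_cast h2

lemma cubeIdempotent_hadamard (i j : ℕ) :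
    cubeIdempotent ℂ d i ⊙ cubeIdempotent ℂ d j =
      (2 ^ d : ℂ)⁻¹ • ∑ h ∈ range (d + 1), cubeParam d h i j • cubeIdempotent ℂ d h := by
  ext x y
  simp only [hadamard_apply, Matrix.smul_apply, Matrix.sum_apply, cubeIdempotent, of_apply,
    smul_eq_mul]
  simp_rw [mul_left_comm, ← mul_sum, sum_cubeParam_mul_krawtchouk _ _ (hammingDist_le x y)]
  ring

lemma card_vertices (d : ℕ) : (Fintype.card (Fin d → ℤˣ) : ℂ) = 2 ^ d := by
  simp

lemma kreinParameter_hypercube (h i j : Fin ((hypercube d).diam + 1)) :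
    kreinParameter (hypercube d) h i j = cubeParam d h i j := by
  have hs := Classical.epsilon_spec (p := fun c : Fin ((hypercube d).diam + 1) → ℂ =>
    primitiveIdempotent (hypercube d) i ⊙ primitiveIdempotent (hypercube d) j =
      (Fintype.card (Fin d → ℤˣ) : ℂ)⁻¹ • ∑ l, c l • primitiveIdempotent (hypercube d) l)
    ⟨fun l => cubeParam d l i j, by
      simp only [primitiveIdempotent_hypercube]
      rw [sum_fin_diam fun l => cubeParam d l i j • cubeIdempotent ℂ d l, card_vertices,
        cubeIdempotent_hadamard]⟩
  rw [kreinParameter]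
  set c := Classical.epsilon fun c : Fin ((hypercube d).diam + 1) → ℂ =>
    primitiveIdempotent (hypercube d) i ⊙ primitiveIdempotent (hypercube d) j =
      (Fintype.card (Fin d → ℤˣ) : ℂ)⁻¹ • ∑ l, c l • primitiveIdempotent (hypercube d) l
  have h2 := congrArg (· * cubeIdempotent ℂ d h) hs
  simp only [primitiveIdempotent_hypercube, card_vertices, cubeIdempotent_hadamard,
    smul_mul_assoc, sum_mul, cubeIdempotent_mul] at h2
  rw [sum_eq_single_of_mem (h : ℕ) (by have := le_of_fin h; rw [mem_range]; omega)
    (fun l _ hl => by rw [if_neg hl, smul_zero]),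
    sum_eq_single_of_mem h (mem_univ _)
      (fun l _ hl => by rw [if_neg (by rwa [← Fin.ext_iff]), smul_zero]),
    if_pos rfl] at h2
  have h3 := smul_right_injective _ (inv_ne_zero (pow_ne_zero d (two_ne_zero (α := ℂ)))) h2
  exact (smul_left_injective ℂ (cubeIdempotent_ne_zero ℂ (le_of_fin h)) h3).symm

lemma kreinParameter_eq_zero_iff (h i j : Fin ((hypercube d).diam + 1)) :
    kreinParameter (hypercube d) h i j = 0 ↔ ¬ Admissible d h i j := by
  rw [kreinParameter_hypercube, ← intersectionNumber_hypercube, Nat.cast_eq_zero,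
    intersectionNumber_eq_zero_iff]

lemma dualValency_hypercube (i : Fin ((hypercube d).diam + 1)) :
    dualValency (hypercube d) i = d.choose i := by
  rw [dualValency, kreinParameter_hypercube, ← intersectionNumber_hypercube, ← valency_hypercube,
    valency]

lemma q_hypercube (i j : Fin ((hypercube d).diam + 1)) :
    q (hypercube d) i j = krawtchouk d i j := by
  have key : ∀ c : Fin ((hypercube d).diam + 1) → ℂ, primitiveIdempotent (hypercube d) i =
      (Fintype.card (Fin d → ℤˣ) : ℂ)⁻¹ • ∑ l, c l • distanceMatrix (hypercube d) l ↔
      ∀ l, c l = krawtchouk d i l := by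
    intro c
    have h1 : ∀ x y (l : Fin ((hypercube d).diam + 1)), hammingDist x y = l →
        ((Fintype.card (Fin d → ℤˣ) : ℂ)⁻¹ • ∑ l, c l • distanceMatrix (hypercube d) l) x y =
          (2 ^ d)⁻¹ * c l := by
      intro x y l hl
      rw [card_vertices, Matrix.smul_apply, Matrix.sum_apply, sum_eq_single_of_mem l (mem_univ _)]
      · simp [distanceMatrix, hypercube_dist, hl]
      · intro m _ hm
        simp [distanceMatrix, hypercube_dist, hl, Fin.val_inj, hm.symm]
    rw [primitiveIdempotent_hypercube]
    constructor
    · intro h l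
      obtain ⟨y, hy⟩ := exists_hammingDist_eq (fun _ : Fin d => (1 : ℤˣ)) (le_of_fin l)
      have h2 := congrFun (congrFun h fun _ => 1) y
      rw [h1 _ _ l hy, cubeIdempotent, of_apply, hy] at h2
      exact (mul_left_cancel₀ (inv_ne_zero (pow_ne_zero d two_ne_zero)) h2).symm
    · intro h
      ext x y
      rw [h1 x y (toFin (hammingDist_le x y)) rfl, h, cubeIdempotent, of_apply]
      rfl
  have hs := Classical.epsilon_spec (p := fun c : Fin ((hypercube d).diam + 1) → ℂ =>
    primitiveIdempotent (hypercube d) i =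
      (Fintype.card (Fin d → ℤˣ) : ℂ)⁻¹ • ∑ l, c l • distanceMatrix (hypercube d) l)
      ⟨fun l => krawtchouk d i l, (key _).2 fun _ => rfl⟩
  exact (key _).1 hs j

lemma qDual_hypercube (i j : Fin ((hypercube d).diam + 1)) :
    qDual (hypercube d) i j = krawtchouk d i j := by
  classical
  have key : ∀ c : Fin ((hypercube d).diam + 1) → ℂ, (∀ x, dualIdempotent (hypercube d) x i =
      (Fintype.card (Fin d → ℤˣ) : ℂ)⁻¹ • ∑ l, c l • dualDistanceMatrix (hypercube d) x l) ↔
      ∀ m ≤ d, (∑ l, c l * krawtchouk d l m) = if (i : ℕ) = m then (2 ^ d) else 0 := by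
    intro c
    have h1 : ∀ x, ((Fintype.card (Fin d → ℤˣ) : ℂ)⁻¹ •
        ∑ l, c l • dualDistanceMatrix (hypercube d) x l) = Matrix.diagonal fun y =>
          (2 ^ d)⁻¹ * ∑ l, c l * krawtchouk d l (hammingDist x y) := by
      intro x
      ext y z
      have h0 : (2 : ℂ) ^ d ≠ 0 := pow_ne_zero _ two_ne_zero
      rw [card_vertices, Matrix.smul_apply, Matrix.sum_apply]
      simp only [dualDistanceMatrix, card_vertices, primitiveIdempotent_hypercube, cubeIdempotent,
        of_apply, mul_inv_cancel_left₀ h0, Matrix.smul_apply, diagonal_apply]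
      split_ifs
      · simp
      · simp
    have h0 : (2 : ℂ) ^ d ≠ 0 := pow_ne_zero _ two_ne_zero
    simp only [h1]
    constructor
    · intro h m hm
      obtain ⟨y, hy⟩ := exists_hammingDist_eq (fun _ : Fin d => (1 : ℤˣ)) hm
      have h2 := congrFun (congrFun (h fun _ => 1) y) y
      simp only [dualIdempotent, diagonal_apply_eq, hypercube_dist, hy] at h2
      rw [← mul_inv_cancel_left₀ h0 (∑ l, _), ← h2]
      simp [eq_comm]
    · intro h x
      ext y z
      simp only [dualIdempotent, diagonal_apply, hypercube_dist]
      rw [h _ (hammingDist_le x y)]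
      simp [h0, eq_comm]
  have hs := Classical.epsilon_spec (p := fun c : Fin ((hypercube d).diam + 1) → ℂ =>
    ∀ x, dualIdempotent (hypercube d) x i =
      (Fintype.card (Fin d → ℤˣ) : ℂ)⁻¹ • ∑ l, c l • dualDistanceMatrix (hypercube d) x l)
      ⟨fun l => krawtchouk d i l, (key _).2 fun m hm => by
        rw [sum_fin_diam fun l => (krawtchouk d i l : ℂ) * krawtchouk d l m,
          sum_krawtchouk_mul_krawtchouk_cast _ hm]⟩
  have h2 := (key _).1 hs
  rw [qDual]
  set c := Classical.epsilon fun c : Fin ((hypercube d).diam + 1) → ℂ =>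
    ∀ x, dualIdempotent (hypercube d) x i =
      (Fintype.card (Fin d → ℤˣ) : ℂ)⁻¹ • ∑ l, c l • dualDistanceMatrix (hypercube d) x l
  have h0 : (2 : ℂ) ^ d ≠ 0 := pow_ne_zero _ two_ne_zero
  -- The defining property of `c` is a linear system with the Krawtchouk matrix; multiplying by that
  -- matrix once more solves for `c j`.
  have h3 : ∑ m ∈ range (d + 1), (∑ l, c l * krawtchouk d l m) * (krawtchouk d m j : ℂ) =
      2 ^ d * c j := by
    simp only [sum_mul]
    rw [sum_comm]
    simp only [mul_assoc, ← mul_sum, sum_krawtchouk_mul_krawtchouk_cast _ (le_of_fin j)]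
    rw [sum_eq_single_of_mem j (mem_univ _), if_pos rfl, mul_comm]
    intro l _ hl
    rw [if_neg (by rwa [← Fin.ext_iff]), mul_zero]
  rw [sum_congr rfl fun m hm => by rw [h2 m (by rw [mem_range] at hm; omega)],
    sum_eq_single_of_mem (i : ℕ) (by have := le_of_fin i; rw [mem_range]; omega)
    (fun m _ hm => by rw [if_neg hm.symm, zero_mul]), if_pos rfl] at h3
  exact (mul_left_cancel₀ h0 h3).symm

end Fin

/-! ### Pairs of families of idempotents satisfying the triple product relations -/

section Pair

variable {A : Type*} [Ring A] [Algebra ℂ A]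

/-- A family of orthogonal idempotents `e 0, …, e d` with sum `1`. -/
structure IdempotentFamily (d : ℕ) (e : ℕ → A) : Prop where
  mul : ∀ l m, e l * e m = if l = m then e l else 0
  eq_zero : ∀ l, d < l → e l = 0
  sum : ∑ l ∈ range (d + 1), e l = 1

/-- The elements `x_i` of the algebra spanned by the idempotents `e_l`. -/
def krawSum (d : ℕ) (e : ℕ → A) (i : ℕ) : A := ∑ l ∈ range (d + 1), (krawtchouk d i l : ℂ) • e l

lemma krawSum_eq_zero {d i : ℕ} (e : ℕ → A) (hi : d < i) : krawSum d e i = 0 :=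
  sum_eq_zero fun l hl => by
    rw [krawtchouk_eq_zero (by rw [mem_range] at hl; omega) hi, Int.cast_zero, zero_smul]

lemma krawSum_zero {d : ℕ} {e : ℕ → A} (he : IdempotentFamily d e) : krawSum d e 0 = 1 := by
  simp [krawSum, krawtchouk_zero_left, he.sum]

lemma sum_smul_krawSum {d i : ℕ} {e : ℕ → A} (hi : i ≤ d) :
    ∑ j ∈ range (d + 1), (krawtchouk d i j : ℂ) • krawSum d e j = (2 ^ d : ℂ) • e i := by
  simp only [krawSum, smul_sum, smul_smul]
  rw [sum_comm]
  simp only [← sum_smul]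
  rw [sum_eq_single_of_mem i (by rw [mem_range]; omega)]
  · rw [sum_krawtchouk_mul_krawtchouk_cast _ hi, if_pos rfl]
  · intro l hl hli
    rw [sum_krawtchouk_mul_krawtchouk_cast _ (by rw [mem_range] at hl; omega), if_neg hli.symm,
      zero_smul]

lemma idempotent_eq_sum_krawSum {d i : ℕ} {e : ℕ → A} (hi : i ≤ d) :
    e i = (2 ^ d : ℂ)⁻¹ • ∑ j ∈ range (d + 1), (krawtchouk d i j : ℂ) • krawSum d e j := by
  rw [sum_smul_krawSum hi, inv_smul_smul₀ (pow_ne_zero _ two_ne_zero)]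

lemma sum_krawSum (d : ℕ) (e : ℕ → A) : ∑ j ∈ range (d + 1), krawSum d e j = (2 ^ d : ℂ) • e 0 := by
  simpa [krawtchouk_zero_left] using sum_smul_krawSum (e := e) (Nat.zero_le d)

namespace IdempotentFamily

variable {d : ℕ} {e : ℕ → A} (he : IdempotentFamily d e)

include he

lemma mul_krawSum (m i : ℕ) : e m * krawSum d e i = (krawtchouk d i m : ℂ) • e m := by
  rcases le_or_gt m d with hm | hm
  · rw [krawSum, mul_sum, sum_eq_single_of_mem m (by rw [mem_range]; omega)]
    · rw [mul_smul_comm, he.mul, if_pos rfl]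
    · intro l _ hl
      rw [mul_smul_comm, he.mul, if_neg hl.symm, smul_zero]
  · rw [he.eq_zero m hm, zero_mul, smul_zero]

lemma krawSum_mul (m i : ℕ) : krawSum d e i * e m = (krawtchouk d i m : ℂ) • e m := by
  rcases le_or_gt m d with hm | hm
  · rw [krawSum, sum_mul, sum_eq_single_of_mem m (by rw [mem_range]; omega)]
    · rw [smul_mul_assoc, he.mul, if_pos rfl]
    · intro l _ hl
      rw [smul_mul_assoc, he.mul, if_neg hl, smul_zero]
  · rw [he.eq_zero m hm, mul_zero, smul_zero]

lemma krawSum_mul_krawSum (i j : ℕ) : krawSum d e i * krawSum d e j =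
    ∑ h ∈ range (d + 1), cubeParam d h i j • krawSum d e h := by
  conv_lhs => rw [krawSum, sum_mul]
  simp only [smul_mul_assoc, he.mul_krawSum, smul_smul]
  simp only [krawSum, smul_sum, smul_smul]
  rw [sum_comm]
  refine sum_congr rfl fun l hl => ?_
  rw [← sum_smul, sum_cubeParam_mul_krawtchouk _ _ (by rw [mem_range] at hl; omega)]

lemma map {B : Type*} [Ring B] [Algebra ℂ B] (f : A →ₐ[ℂ] B) :
    IdempotentFamily d (fun i => f (e i)) where
  mul l m := by rw [← map_mul, he.mul]; split_ifs <;> simp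
  eq_zero l hl := by rw [he.eq_zero l hl, map_zero]
  sum := by rw [← map_sum, he.sum, map_one]

end IdempotentFamily

lemma map_krawSum {B : Type*} [Ring B] [Algebra ℂ B] (f : A →ₐ[ℂ] B) (d : ℕ) (e : ℕ → A) (i : ℕ) :
    krawSum d (fun i => f (e i)) i = f (krawSum d e i) := by
  simp [krawSum, map_sum]

/-- The relations of the generalized Terwilliger algebra of the `d`-cube, in terms of the
idempotents `e_i` and `e_i^*`. -/
structure CubePair (d : ℕ) (e es : ℕ → A) : Prop where
  family : IdempotentFamily d e
  familyDual : IdempotentFamily d es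
  triple : ∀ h i j, ¬ Admissible d h i j → es h * krawSum d e i * es j = 0
  tripleDual : ∀ h i j, ¬ Admissible d h i j → e h * krawSum d es i * e j = 0

/-- The element `2^d ∑_i k_i⁻¹ e_i^* e_0 e_i^*`. -/
def primaryIdempotent (d : ℕ) (e es : ℕ → A) : A :=
  (2 ^ d : ℂ) • ∑ i ∈ range (d + 1), (d.choose i : ℂ)⁻¹ • (es i * e 0 * es i)

namespace CubePair

variable {d : ℕ} {e es : ℕ → A}

/-- Self-duality of the cube in algebraic form: both families obey the same relations, so each later
statement also holds with the roles exchanged. -/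
lemma swap (P : CubePair d e es) : CubePair d es e :=
  ⟨P.familyDual, P.family, P.tripleDual, P.triple⟩

lemma map (P : CubePair d e es) {B : Type*} [Ring B] [Algebra ℂ B] (f : A →ₐ[ℂ] B) :
    CubePair d (fun i => f (e i)) (fun i => f (es i)) where
  family := P.family.map f
  familyDual := P.familyDual.map f
  triple h i j hn := by rw [map_krawSum, ← map_mul, ← map_mul, P.triple h i j hn, map_zero]
  tripleDual h i j hn := by rw [map_krawSum, ← map_mul, ← map_mul, P.tripleDual h i j hn, map_zero]

/-- When $e_h^*$ is expanded in the $x_j^*$, the triple products $e_0x_j^*e_0$ vanish for $j\ne0$,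
leaving the coefficient of $x_0^*=1$. -/
lemma e_zero_mul_es_mul_e_zero (P : CubePair d e es) {h : ℕ} (hh : h ≤ d) :
    e 0 * es h * e 0 = ((2 ^ d : ℂ)⁻¹ * d.choose h) • e 0 := by
  rw [idempotent_eq_sum_krawSum (e := es) hh, mul_smul_comm, smul_mul_assoc, mul_sum, sum_mul,
    sum_eq_single_of_mem 0 (by simp)]
  · rw [krawSum_zero P.familyDual, krawtchouk_zero_right, mul_smul_comm, mul_one, smul_mul_assoc,
      P.family.mul, if_pos rfl, smul_smul]
    norm_cast
  · intro j _ hj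
    rw [mul_smul_comm, smul_mul_assoc, P.tripleDual, smul_zero]
    rintro ⟨-, -, h1, -, -⟩
    omega

lemma es_mul_krawSum_mul_es_zero (P : CubePair d e es) {h i : ℕ} (hi : i ≠ h) :
    es h * krawSum d e i * es 0 = 0 := by
  refine P.triple _ _ _ ?_
  rintro ⟨-, h1, h2, -, -⟩
  omega

lemma es_zero_mul_krawSum_mul_es (P : CubePair d e es) {h i : ℕ} (hi : i ≠ h) :
    es 0 * krawSum d e i * es h = 0 := by
  refine P.triple _ _ _ ?_
  rintro ⟨-, -, h1, h2, -⟩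
  omega

/-- The relations leave only $e_h^*$ on the left of $x_he_0^*$. In $2^de_0=\sum_ix_i$, placed
between $e_h^*$ and $e_0^*$, only the term $i=h$ survives. -/
lemma krawSum_mul_es_zero (P : CubePair d e es) {h : ℕ} (hh : h ≤ d) :
    krawSum d e h * es 0 = (2 ^ d : ℂ) • (es h * e 0 * es 0) := by
  have h1 : krawSum d e h * es 0 = es h * krawSum d e h * es 0 := by
    conv_lhs => rw [← one_mul (krawSum d e h), ← P.familyDual.sum, sum_mul, sum_mul]
    exact sum_eq_single_of_mem h (by rw [mem_range]; omega) fun m _ hm =>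
      P.es_mul_krawSum_mul_es_zero hm.symm
  rw [h1, ← smul_mul_assoc, ← mul_smul_comm, ← sum_krawSum, mul_sum, sum_mul]
  exact (sum_eq_single_of_mem h (by rw [mem_range]; omega) fun m _ hm =>
    P.es_mul_krawSum_mul_es_zero hm).symm

lemma es_zero_mul_krawSum (P : CubePair d e es) {h : ℕ} (hh : h ≤ d) :
    es 0 * krawSum d e h = (2 ^ d : ℂ) • (es 0 * e 0 * es h) := by
  have h1 : es 0 * krawSum d e h = es 0 * krawSum d e h * es h := by
    conv_lhs => rw [← mul_one (es 0 * krawSum d e h), ← P.familyDual.sum, mul_sum]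
    exact sum_eq_single_of_mem h (by rw [mem_range]; omega) fun m _ hm =>
      P.es_zero_mul_krawSum_mul_es hm.symm
  rw [h1, ← smul_mul_assoc, ← mul_smul_comm, ← sum_krawSum, mul_sum, sum_mul]
  exact (sum_eq_single_of_mem h (by rw [mem_range]; omega) fun m _ hm =>
    P.es_zero_mul_krawSum_mul_es hm).symm

/-- Expanding $e_h^*$ in the $x_j^*$ and using the dual of `krawSum_mul_es_zero` trades $e_h^*e_0$
for the $e_je_0^*e_0$. This is the bridge between the two expressions for $u_0$. -/
lemma es_mul_e_zero (P : CubePair d e es) {h : ℕ} (hh : h ≤ d) :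
    es h * e 0 = ∑ j ∈ range (d + 1), (krawtchouk d h j : ℂ) • (e j * es 0 * e 0) := by
  rw [idempotent_eq_sum_krawSum (e := es) hh, smul_mul_assoc, sum_mul, smul_sum]
  refine sum_congr rfl fun j hj => ?_
  rw [smul_mul_assoc, P.swap.krawSum_mul_es_zero (by rw [mem_range] at hj; omega), smul_comm,
    inv_smul_smul₀ (pow_ne_zero _ two_ne_zero)]

lemma e_zero_mul_es (P : CubePair d e es) {h : ℕ} (hh : h ≤ d) :
    e 0 * es h = ∑ j ∈ range (d + 1), (krawtchouk d h j : ℂ) • (e 0 * es 0 * e j) := by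
  rw [idempotent_eq_sum_krawSum (e := es) hh, mul_smul_comm, mul_sum, smul_sum]
  refine sum_congr rfl fun j hj => ?_
  rw [mul_smul_comm, P.swap.es_zero_mul_krawSum (by rw [mem_range] at hj; omega), smul_comm,
    inv_smul_smul₀ (pow_ne_zero _ two_ne_zero)]

lemma smul_e_zero (P : CubePair d e es) {h : ℕ} (hh : h ≤ d) :
    ((2 ^ d : ℂ) * (d.choose h : ℂ)⁻¹) • (e 0 * es h * e 0) = e 0 := by
  have h1 : (2 : ℂ) ^ d ≠ 0 := pow_ne_zero _ two_ne_zero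
  have h2 : (d.choose h : ℂ) ≠ 0 := by exact_mod_cast (Nat.choose_pos hh).ne'
  rw [P.e_zero_mul_es_mul_e_zero hh, smul_smul]
  convert one_smul ℂ (e 0) using 2
  field_simp

lemma primaryIdempotent_mul_es (P : CubePair d e es) {h : ℕ} (hh : h ≤ d) :
    primaryIdempotent d e es * es h =
      ((2 ^ d : ℂ) * (d.choose h : ℂ)⁻¹) • (es h * e 0 * es h) := by
  rw [primaryIdempotent, smul_mul_assoc, sum_mul, ← smul_smul,
    sum_eq_single_of_mem h (by rw [mem_range]; omega)]
  · rw [smul_mul_assoc, mul_assoc _ (es h), P.familyDual.mul, if_pos rfl]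
  · intro i _ hi
    rw [smul_mul_assoc, mul_assoc _ (es i), P.familyDual.mul, if_neg hi, mul_zero, smul_zero]

lemma es_mul_primaryIdempotent (P : CubePair d e es) {h : ℕ} (hh : h ≤ d) :
    es h * primaryIdempotent d e es =
      ((2 ^ d : ℂ) * (d.choose h : ℂ)⁻¹) • (es h * e 0 * es h) := by
  rw [primaryIdempotent, mul_smul_comm, mul_sum, ← smul_smul,
    sum_eq_single_of_mem h (by rw [mem_range]; omega)]
  · rw [mul_smul_comm, mul_assoc (es h) (e 0), ← mul_assoc, P.familyDual.mul, if_pos rfl,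
      ← mul_assoc]
  · intro i _ hi
    rw [mul_smul_comm, mul_assoc (es i) (e 0), ← mul_assoc, P.familyDual.mul, if_neg hi.symm,
      zero_mul, smul_zero]

lemma commute_primaryIdempotent_es (P : CubePair d e es) (h : ℕ) :
    primaryIdempotent d e es * es h = es h * primaryIdempotent d e es := by
  rcases le_or_gt h d with hh | hh
  · rw [P.primaryIdempotent_mul_es hh, P.es_mul_primaryIdempotent hh]
  · rw [P.familyDual.eq_zero h hh, mul_zero, zero_mul]

lemma primaryIdempotent_mul_es_mul_e_zero (P : CubePair d e es) {h : ℕ} (hh : h ≤ d) :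
    primaryIdempotent d e es * (es h * e 0) = es h * e 0 := by
  rw [← mul_assoc, P.primaryIdempotent_mul_es hh, smul_mul_assoc, mul_assoc (es h) (e 0),
    mul_assoc (es h), ← mul_smul_comm, P.smul_e_zero hh]

lemma e_zero_mul_es_mul_primaryIdempotent (P : CubePair d e es) {h : ℕ} (hh : h ≤ d) :
    e 0 * es h * primaryIdempotent d e es = e 0 * es h := by
  rw [mul_assoc, P.es_mul_primaryIdempotent hh, mul_smul_comm, ← mul_assoc, ← mul_assoc,
    ← smul_mul_assoc, P.smul_e_zero hh]

lemma primaryIdempotentDual_mul_es_mul_e_zero (P : CubePair d e es) {h : ℕ} (hh : h ≤ d) :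
    primaryIdempotent d es e * (es h * e 0) = es h * e 0 := by
  rw [P.es_mul_e_zero hh, mul_sum]
  refine sum_congr rfl fun j hj => ?_
  rw [mul_smul_comm, ← mul_assoc,
    P.swap.primaryIdempotent_mul_es_mul_e_zero (by rw [mem_range] at hj; omega)]

lemma e_zero_mul_es_mul_primaryIdempotentDual (P : CubePair d e es) {h : ℕ} (hh : h ≤ d) :
    e 0 * es h * primaryIdempotent d es e = e 0 * es h := by
  rw [P.e_zero_mul_es hh, sum_mul]
  refine sum_congr rfl fun j hj => ?_
  rw [smul_mul_assoc, mul_assoc (e 0), mul_assoc (e 0),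
    P.swap.e_zero_mul_es_mul_primaryIdempotent (by rw [mem_range] at hj; omega)]

/-- Both sides equal the product of the dual expression with the original one, since each factor
absorbs the summands of the other. -/
lemma primaryIdempotent_eq_dual (P : CubePair d e es) :
    primaryIdempotent d e es = primaryIdempotent d es e := by
  trans primaryIdempotent d es e * primaryIdempotent d e es
  · conv_rhs => rw [primaryIdempotent.eq_1 d e es, mul_smul_comm, mul_sum]
    rw [primaryIdempotent]
    congr 1
    refine sum_congr rfl fun i hi => ?_
    rw [mul_smul_comm, ← mul_assoc,
      P.primaryIdempotentDual_mul_es_mul_e_zero (by rw [mem_range] at hi; omega)]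
  · conv_lhs => rw [primaryIdempotent.eq_1 d es e, smul_mul_assoc, sum_mul]
    conv_rhs => rw [primaryIdempotent]
    congr 1
    refine sum_congr rfl fun i hi => ?_
    rw [smul_mul_assoc, mul_assoc (e i), mul_assoc (e i),
      P.swap.e_zero_mul_es_mul_primaryIdempotentDual (by rw [mem_range] at hi; omega)]

lemma isIdempotentElem_primaryIdempotent (P : CubePair d e es) :
    IsIdempotentElem (primaryIdempotent d e es) := by
  rw [IsIdempotentElem]
  conv_lhs => rw [primaryIdempotent.eq_1 d e es]
  conv_rhs => rw [primaryIdempotent.eq_1 d e es]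
  rw [mul_smul_comm, mul_sum]
  congr 1
  refine sum_congr rfl fun i hi => ?_
  rw [mul_smul_comm, ← mul_assoc, ← primaryIdempotent.eq_1,
    P.primaryIdempotent_mul_es_mul_e_zero (by rw [mem_range] at hi; omega)]

lemma commute_primaryIdempotent_e (P : CubePair d e es) (h : ℕ) :
    primaryIdempotent d e es * e h = e h * primaryIdempotent d e es := by
  rw [P.primaryIdempotent_eq_dual]
  exact P.swap.commute_primaryIdempotent_es h

lemma e_zero_mul_primaryIdempotent (P : CubePair d e es) :
    e 0 * primaryIdempotent d e es = e 0 := by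
  conv_lhs => rw [← mul_one (e 0), ← P.familyDual.sum, mul_sum, sum_mul]
  rw [sum_congr rfl fun h hh => P.e_zero_mul_es_mul_primaryIdempotent
    (h := h) (by rw [mem_range] at hh; omega), ← mul_sum, P.familyDual.sum, mul_one]

end CubePair

end Pair

/-! ### The presentation of the generalized Terwilliger algebra of the cube -/

section Algebra

variable {A : Type*} [Ring A] [Algebra ℂ A]

lemma krawSum_of_mul {d : ℕ} {x : ℕ → A}
    {e : ℕ → A} (he : ∀ i ≤ d, e i =
      (2 ^ d : ℂ)⁻¹ • ∑ j ∈ range (d + 1), (krawtchouk d i j : ℂ) • x j)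
    {i : ℕ} (hi : i ≤ d) : krawSum d e i = x i := by
  have h0 : (2 : ℂ) ^ d ≠ 0 := pow_ne_zero _ two_ne_zero
  rw [krawSum, sum_congr rfl fun l hl => by rw [he l (by rw [mem_range] at hl; omega), smul_comm],
    ← smul_sum]
  simp only [smul_sum (N := A) (r := (_ : ℂ)), smul_smul]
  rw [sum_comm]
  simp only [← mul_sum, ← sum_smul]
  rw [sum_eq_single_of_mem i (by rw [mem_range]; omega)]
  · rw [sum_krawtchouk_mul_krawtchouk_cast _ hi, if_pos rfl, inv_mul_cancel₀ h0, one_smul]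
  · intro l hl hli
    rw [sum_krawtchouk_mul_krawtchouk_cast _ (by rw [mem_range] at hl; omega), if_neg hli.symm,
      mul_zero, zero_smul]

lemma idempotentFamily_of_mul {d : ℕ} {x : ℕ → A} (hx0 : x 0 = 1)
    (hx : ∀ i ≤ d, ∀ j ≤ d, x i * x j = ∑ h ∈ range (d + 1), cubeParam d h i j • x h)
    {e : ℕ → A} (he : ∀ i ≤ d, e i =
      (2 ^ d : ℂ)⁻¹ • ∑ j ∈ range (d + 1), (krawtchouk d i j : ℂ) • x j)
    (he' : ∀ i, d < i → e i = 0) : IdempotentFamily d e := by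
  have h0 : (2 : ℂ) ^ d ≠ 0 := pow_ne_zero _ two_ne_zero
  have hr : ∀ {l}, l ∈ range (d + 1) → l ≤ d := fun hl => by rw [mem_range] at hl; omega
  -- The multiplication relations make each $e_l$ a common eigenvector of the $x_j$, with the
  -- Krawtchouk numbers as eigenvalues; orthogonality then follows by expanding $e_m$.
  have hmul : ∀ l ≤ d, ∀ j ≤ d, e l * x j = (krawtchouk d j l : ℂ) • e l := by
    intro l hl j hj
    rw [he l hl, smul_mul_assoc, sum_mul, smul_comm]
    congr 1
    rw [sum_congr rfl fun a ha => by rw [smul_mul_assoc, hx a (hr ha) j hj, smul_sum], sum_comm,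
      smul_sum]
    refine sum_congr rfl fun h hh => ?_
    simp only [smul_smul, ← sum_smul]
    congr 1
    simp only [cubeParam, mul_sum]
    rw [sum_comm, sum_eq_single_of_mem l (by rw [mem_range]; omega)]
    · have := sum_krawtchouk_mul_krawtchouk_cast l hl
      rw [if_pos rfl] at this
      calc _ = (∑ a ∈ range (d + 1), (krawtchouk d l a : ℂ) * krawtchouk d a l) *
            ((2 ^ d)⁻¹ * krawtchouk d j l * krawtchouk d l h) := by
              rw [sum_mul]; exact sum_congr rfl fun _ _ => by ring
        _ = _ := by rw [this]; field_simp
    · intro m hm hml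
      have := sum_krawtchouk_mul_krawtchouk_cast l (hr hm)
      rw [if_neg hml.symm] at this
      calc _ = (∑ a ∈ range (d + 1), (krawtchouk d l a : ℂ) * krawtchouk d a m) *
            ((2 ^ d)⁻¹ * krawtchouk d j m * krawtchouk d m h) := by
              rw [sum_mul]; exact sum_congr rfl fun _ _ => by ring
        _ = _ := by rw [this, zero_mul]
  refine ⟨fun l m => ?_, he', ?_⟩
  · rcases le_or_gt l d with hl | hl
    · rcases le_or_gt m d with hm | hm
      · rw [he m hm, mul_smul_comm, mul_sum,
          sum_congr rfl fun j hj => by rw [mul_smul_comm, hmul l hl j (hr hj), smul_smul],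
          ← sum_smul, sum_krawtchouk_mul_krawtchouk_cast _ hl]
        split_ifs with h1 h2 h2
        · rw [inv_smul_smul₀ h0]
        · exact absurd h1.symm h2
        · exact absurd h2.symm h1
        · rw [zero_smul, smul_zero]
      · rw [he' m hm, mul_zero, if_neg (by omega)]
    · rw [he' l hl, zero_mul, ite_self]
  · have := krawSum_of_mul he (Nat.zero_le d)
    simpa [krawSum, krawtchouk_zero_left, hx0] using this

end Algebra

section Cube

variable {d : ℕ}

/-- The element `e_i` of `𝒯_d`, indexed by the natural numbers. -/
def cubeE (d i : ℕ) : CubeAlgebra d := if h : i ≤ d then e (hypercube d) (toFin h) else 0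

/-- The element `e_i^*` of `𝒯_d`, indexed by the natural numbers. -/
def cubeEDual (d i : ℕ) : CubeAlgebra d := if h : i ≤ d then eDual (hypercube d) (toFin h) else 0

lemma e_eq_cubeE (i : Fin ((hypercube d).diam + 1)) : e (hypercube d) i = cubeE d i := by
  rw [cubeE, dif_pos (le_of_fin i)]
  rfl

lemma eDual_eq_cubeEDual (i : Fin ((hypercube d).diam + 1)) :
    eDual (hypercube d) i = cubeEDual d i := by
  rw [cubeEDual, dif_pos (le_of_fin i)]
  rfl

/-- The generator `x_i` of `𝒯_d`. -/
def cubeX (d i : ℕ) : CubeAlgebra d :=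
  if h : i ≤ d then RingQuot.mkAlgHom ℂ (Rel (hypercube d)) (freeX _ (toFin h)) else 0

/-- The generator `x_i^*` of `𝒯_d`. -/
def cubeXDual (d i : ℕ) : CubeAlgebra d :=
  if h : i ≤ d then RingQuot.mkAlgHom ℂ (Rel (hypercube d)) (freeXDual _ (toFin h)) else 0

lemma mk_freeX (i : Fin ((hypercube d).diam + 1)) :
    RingQuot.mkAlgHom ℂ (Rel (hypercube d)) (freeX _ i) = cubeX d i := by
  rw [cubeX, dif_pos (le_of_fin i)]
  rfl

lemma mk_freeXDual (i : Fin ((hypercube d).diam + 1)) :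
    RingQuot.mkAlgHom ℂ (Rel (hypercube d)) (freeXDual _ i) = cubeXDual d i := by
  rw [cubeXDual, dif_pos (le_of_fin i)]
  rfl

lemma cubeE_eq_sum {i : ℕ} (hi : i ≤ d) :
    cubeE d i = (2 ^ d : ℂ)⁻¹ • ∑ j ∈ range (d + 1), (krawtchouk d i j : ℂ) • cubeX d j := by
  rw [cubeE, dif_pos hi, e, freeE, map_smul, map_sum, card_vertices]
  simp only [map_smul, mk_freeX, q_hypercube]
  rw [sum_fin_diam fun j => (krawtchouk d (toFin hi) j : ℂ) • cubeX d j]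
  rfl

lemma cubeEDual_eq_sum {i : ℕ} (hi : i ≤ d) :
    cubeEDual d i =
      (2 ^ d : ℂ)⁻¹ • ∑ j ∈ range (d + 1), (krawtchouk d i j : ℂ) • cubeXDual d j := by
  rw [cubeEDual, dif_pos hi, eDual, freeEDual, map_smul, map_sum, card_vertices]
  simp only [map_smul, mk_freeXDual, qDual_hypercube]
  rw [sum_fin_diam fun j => (krawtchouk d (toFin hi) j : ℂ) • cubeXDual d j]
  rfl

lemma cubeX_zero : cubeX d 0 = 1 := by
  have h := RingQuot.mkAlgHom_rel ℂ (Rel.x_zero (G := hypercube d))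
  rwa [mk_freeX, map_one] at h

lemma cubeXDual_zero : cubeXDual d 0 = 1 := by
  have h := RingQuot.mkAlgHom_rel ℂ (Rel.xDual_zero (G := hypercube d))
  rwa [mk_freeXDual, map_one] at h

lemma cubeX_mul {i j : ℕ} (hi : i ≤ d) (hj : j ≤ d) :
    cubeX d i * cubeX d j = ∑ h ∈ range (d + 1), cubeParam d h i j • cubeX d h := by
  have h := RingQuot.mkAlgHom_rel ℂ (Rel.x_mul (G := hypercube d) (toFin hi) (toFin hj))
  simp only [map_mul, map_sum, map_smul, mk_freeX, intersectionNumber_hypercube] at h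
  rwa [sum_fin_diam fun h => cubeParam d h (toFin hi) (toFin hj) • cubeX d h] at h

lemma cubeXDual_mul {i j : ℕ} (hi : i ≤ d) (hj : j ≤ d) :
    cubeXDual d i * cubeXDual d j = ∑ h ∈ range (d + 1), cubeParam d h i j • cubeXDual d h := by
  have h := RingQuot.mkAlgHom_rel ℂ (Rel.xDual_mul (G := hypercube d) (toFin hi) (toFin hj))
  simp only [map_mul, map_sum, map_smul, mk_freeXDual, kreinParameter_hypercube] at h
  rwa [sum_fin_diam fun h => cubeParam d h (toFin hi) (toFin hj) • cubeXDual d h] at h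

lemma cubeE_eq_zero {i : ℕ} (hi : d < i) : cubeE d i = 0 := dif_neg (by omega)

lemma cubeEDual_eq_zero {i : ℕ} (hi : d < i) : cubeEDual d i = 0 := dif_neg (by omega)

lemma krawSum_cubeE {i : ℕ} (hi : i ≤ d) : krawSum d (cubeE d) i = cubeX d i :=
  krawSum_of_mul (fun _ => cubeE_eq_sum) hi

lemma krawSum_cubeEDual {i : ℕ} (hi : i ≤ d) : krawSum d (cubeEDual d) i = cubeXDual d i :=
  krawSum_of_mul (fun _ => cubeEDual_eq_sum) hi

lemma cubePair_cube (d : ℕ) : CubePair d (cubeE d) (cubeEDual d) where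
  family := idempotentFamily_of_mul cubeX_zero (fun _ hi _ hj => cubeX_mul hi hj)
    (fun _ => cubeE_eq_sum) (fun _ => cubeE_eq_zero)
  familyDual := idempotentFamily_of_mul cubeXDual_zero (fun _ hi _ hj => cubeXDual_mul hi hj)
    (fun _ => cubeEDual_eq_sum) (fun _ => cubeEDual_eq_zero)
  triple h i j hn := by
    rcases lt_or_ge d h with hh | hh
    · rw [cubeEDual_eq_zero hh, zero_mul, zero_mul]
    rcases lt_or_ge d i with hi | hi
    · rw [krawSum_eq_zero _ hi, mul_zero, zero_mul]
    rcases lt_or_ge d j with hj | hj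
    · rw [cubeEDual_eq_zero hj, mul_zero]
    have := RingQuot.mkAlgHom_rel ℂ (Rel.triple (G := hypercube d) (toFin hh) (toFin hi) (toFin hj)
      ((intersectionNumber_eq_zero_iff _ _ _).2 hn))
    rw [map_mul, map_mul, mk_freeX, map_zero] at this
    rw [krawSum_cubeE hi]
    rwa [← eDual, ← eDual, eDual_eq_cubeEDual, eDual_eq_cubeEDual] at this
  tripleDual h i j hn := by
    rcases lt_or_ge d h with hh | hh
    · rw [cubeE_eq_zero hh, zero_mul, zero_mul]
    rcases lt_or_ge d i with hi | hi
    · rw [krawSum_eq_zero _ hi, mul_zero, zero_mul]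
    rcases lt_or_ge d j with hj | hj
    · rw [cubeE_eq_zero hj, mul_zero]
    have := RingQuot.mkAlgHom_rel ℂ (Rel.tripleDual (G := hypercube d) (toFin hh) (toFin hi)
      (toFin hj) ((kreinParameter_eq_zero_iff _ _ _).2 hn))
    rw [map_mul, map_mul, mk_freeXDual, map_zero] at this
    rw [krawSum_cubeEDual hi]
    rwa [← e, ← e, e_eq_cubeE, e_eq_cubeE] at this

lemma cubeAlgebra_subalgebra_eq_top {S : Subalgebra ℂ (CubeAlgebra d)} (h1 : ∀ i, cubeE d i ∈ S)
    (h2 : ∀ i, cubeEDual d i ∈ S) : S = ⊤ := by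
  rw [eq_top_iff]
  rintro a -
  obtain ⟨b, rfl⟩ := RingQuot.mkAlgHom_surjective ℂ (Rel (hypercube d)) a
  induction b using FreeAlgebra.induction with
  | grade0 r => rw [AlgHom.commutes]; exact S.algebraMap_mem r
  | grade1 g =>
    cases g with
    | x i =>
      rw [← freeX, mk_freeX, ← krawSum_cubeE (le_of_fin i)]
      exact S.sum_mem fun l _ => S.smul_mem (h1 l) _
    | xDual i =>
      rw [← freeXDual, mk_freeXDual, ← krawSum_cubeEDual (le_of_fin i)]
      exact S.sum_mem fun l _ => S.smul_mem (h2 l) _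
  | mul a b ha hb => rw [map_mul]; exact S.mul_mem ha hb
  | add a b ha hb => rw [map_add]; exact S.add_mem ha hb

lemma cubeAlgebra_algHom_ext {A : Type*} [Ring A] [Algebra ℂ A] {f g : CubeAlgebra d →ₐ[ℂ] A}
    (h1 : ∀ i, f (cubeE d i) = g (cubeE d i)) (h2 : ∀ i, f (cubeEDual d i) = g (cubeEDual d i)) :
    f = g := by
  have h : AlgHom.equalizer f g = ⊤ := cubeAlgebra_subalgebra_eq_top h1 h2
  refine AlgHom.ext fun a => ?_
  have : a ∈ AlgHom.equalizer f g := by rw [h]; trivial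
  exact this

/-- The universal property of $\mathcal T_d$ in terms of idempotents. It produces the primary
representation, the map onto the smaller algebra, and the map from the latter to the quotient by
$u_0$. -/
lemma CubePair.exists_lift {A : Type*} [Ring A] [Algebra ℂ A] {e es : ℕ → A}
    (P : CubePair d e es) : ∃ f : CubeAlgebra d →ₐ[ℂ] A,
      (∀ i, f (cubeE d i) = e i) ∧ ∀ i, f (cubeEDual d i) = es i := by
  set φ : Free (hypercube d) →ₐ[ℂ] A := FreeAlgebra.lift ℂ fun g => match g with
    | .x i => krawSum d e i
    | .xDual i => krawSum d es i with hφ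
  have hx : ∀ i, φ (freeX _ i) = krawSum d e i := fun i => by
    rw [hφ, freeX, FreeAlgebra.lift_ι_apply]
  have hxs : ∀ i, φ (freeXDual _ i) = krawSum d es i := fun i => by
    rw [hφ, freeXDual, FreeAlgebra.lift_ι_apply]
  have he : ∀ i, φ (freeE _ i) = e i := fun i => by
    rw [freeE, map_smul, map_sum, card_vertices, idempotent_eq_sum_krawSum (e := e) (le_of_fin i)]
    simp only [map_smul, hx, q_hypercube]
    rw [sum_fin_diam fun j => (krawtchouk d i j : ℂ) • krawSum d e j]
  have hes : ∀ i, φ (freeEDual _ i) = es i := fun i => by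
    rw [freeEDual, map_smul, map_sum, card_vertices,
      idempotent_eq_sum_krawSum (e := es) (le_of_fin i)]
    simp only [map_smul, hxs, qDual_hypercube]
    rw [sum_fin_diam fun j => (krawtchouk d i j : ℂ) • krawSum d es j]
  have hrel : ∀ ⦃a b⦄, Rel (hypercube d) a b → φ a = φ b := by
    rintro _ _ (_ | _ | ⟨i, j⟩ | ⟨i, j⟩ | ⟨h, i, j, hp⟩ | ⟨h, i, j, hp⟩)
    · rw [hx, map_one]; exact krawSum_zero P.family
    · rw [hxs, map_one]; exact krawSum_zero P.familyDual
    · rw [map_mul, hx, hx, P.family.krawSum_mul_krawSum, map_sum]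
      simp only [map_smul, hx, intersectionNumber_hypercube]
      rw [sum_fin_diam fun h => cubeParam d h i j • krawSum d e h]
    · rw [map_mul, hxs, hxs, P.familyDual.krawSum_mul_krawSum, map_sum]
      simp only [map_smul, hxs, kreinParameter_hypercube]
      rw [sum_fin_diam fun h => cubeParam d h i j • krawSum d es h]
    · rw [map_mul, map_mul, hes, hx, hes, map_zero]
      exact P.triple _ _ _ ((intersectionNumber_eq_zero_iff _ _ _).1 hp)
    · rw [map_mul, map_mul, he, hxs, he, map_zero]
      exact P.tripleDual _ _ _ ((kreinParameter_eq_zero_iff _ _ _).1 hp)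
  refine ⟨RingQuot.liftAlgHom ℂ ⟨φ, hrel⟩, fun i => ?_, fun i => ?_⟩
  · rcases le_or_gt i d with hi | hi
    · rw [cubeE, dif_pos hi, Terwilliger.e, RingQuot.liftAlgHom_mkAlgHom_apply]
      exact he _
    · rw [cubeE_eq_zero hi, map_zero, P.family.eq_zero i hi]
  · rcases le_or_gt i d with hi | hi
    · rw [cubeEDual, dif_pos hi, eDual, RingQuot.liftAlgHom_mkAlgHom_apply]
      exact hes _
    · rw [cubeEDual_eq_zero hi, map_zero, P.familyDual.eq_zero i hi]

lemma u₀_hypercube (d : ℕ) :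
    u₀ (hypercube d) = primaryIdempotent d (cubeE d) (cubeEDual d) := by
  rw [u₀, card_vertices, primaryIdempotent, ← sum_fin_diam fun i => (d.choose i : ℂ)⁻¹ •
    (cubeEDual d i * cubeE d 0 * cubeEDual d i)]
  simp only [valency_hypercube, e_eq_cubeE, eDual_eq_cubeEDual, Fin.val_zero]

lemma u₀Dual_hypercube (d : ℕ) :
    u₀Dual (hypercube d) = primaryIdempotent d (cubeEDual d) (cubeE d) := by
  rw [u₀Dual, card_vertices, primaryIdempotent, ← sum_fin_diam fun i => (d.choose i : ℂ)⁻¹ •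
    (cubeE d i * cubeEDual d 0 * cubeE d i)]
  simp only [dualValency_hypercube, e_eq_cubeE, eDual_eq_cubeEDual, Fin.val_zero]

end Cube

/-! ### Passing between the `d`-cube and the `(d + 2)`-cube -/

section Shift

variable {A : Type*} [Ring A]

/-- The family `0, e 0, e 1, …`. -/
def shiftUp (e : ℕ → A) : ℕ → A
  | 0 => 0
  | l + 1 => e l

lemma shiftUp_succ {e : ℕ → A} (h : e 0 = 0) : shiftUp (fun l => e (l + 1)) = e := by
  ext l
  cases l with
  | zero => exact h.symm
  | succ l => rfl

variable {d : ℕ} {e es : ℕ → A}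

lemma IdempotentFamily.shiftUp (he : IdempotentFamily d e) :
    IdempotentFamily (d + 2) (shiftUp e) where
  mul l m := by
    cases l <;> cases m <;> simp [Terwilliger.shiftUp, he.mul]
  eq_zero l hl := by
    cases l with
    | zero => rfl
    | succ l => exact he.eq_zero l (by omega)
  sum := by
    rw [sum_range_succ', sum_range_succ]
    simp only [Terwilliger.shiftUp]
    rw [he.sum, he.eq_zero (d + 1) (by omega), add_zero, add_zero]

lemma IdempotentFamily.shiftDown (he : IdempotentFamily (d + 2) e) (h0 : e 0 = 0)
    (h1 : e (d + 2) = 0) : IdempotentFamily d fun l => e (l + 1) where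
  mul l m := by simp [he.mul]
  eq_zero l hl := by
    rcases Nat.lt_or_ge (d + 1) l with h | h
    · exact he.eq_zero _ (by omega)
    · rw [show l = d + 1 by omega, h1]
  sum := by
    have := he.sum
    rwa [sum_range_succ', sum_range_succ, h0, h1, add_zero, add_zero] at this

variable [Algebra ℂ A]

lemma krawSum_shiftUp (he : e (d + 1) = 0) (i : ℕ) : krawSum (d + 2) (shiftUp e) i =
    ∑ l ∈ range (d + 1), (krawtchouk (d + 2) i (l + 1) : ℂ) • e l := by
  rw [krawSum, sum_range_succ', sum_range_succ]
  simp [shiftUp, he]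

lemma krawSum_shiftUp_add_two (he : e (d + 1) = 0) (i : ℕ) :
    krawSum (d + 2) (shiftUp e) (i + 2) = krawSum d e (i + 2) - krawSum d e i := by
  rw [krawSum_shiftUp he, krawSum, krawSum, ← sum_sub_distrib]
  refine sum_congr rfl fun l hl => ?_
  rw [krawtchouk_add_two _ _ _ (by rw [mem_range] at hl; omega), Int.cast_sub, sub_smul]

lemma krawSum_shiftUp_of_lt (he : e (d + 1) = 0) {i : ℕ} (hi : i < 2) :
    krawSum (d + 2) (shiftUp e) i = krawSum d e i := by
  rw [krawSum_shiftUp he, krawSum]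
  refine sum_congr rfl fun l hl => ?_
  rw [krawtchouk_add_two_of_lt (by rw [mem_range] at hl; omega) hi]

/-- By `krawSum_shiftUp_add_two` the new $x_{i+2}$ is $x_{i+2}-x_i$. If $(h+1,i+2,j+1)$ is
inadmissible for $d+2$, then both $(h,i+2,j)$ and $(h,i,j)$ are inadmissible for $d$. -/
lemma triple_shiftUp (he : e (d + 1) = 0)
    (ht : ∀ h i j, ¬ Admissible d h i j → es h * krawSum d e i * es j = 0)
    {h i j : ℕ} (hn : ¬ Admissible (d + 2) h i j) :
    shiftUp es h * krawSum (d + 2) (shiftUp e) i * shiftUp es j = 0 := by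
  cases h with
  | zero => simp [shiftUp]
  | succ h =>
    cases j with
    | zero => simp [shiftUp]
    | succ j =>
      simp only [shiftUp]
      rcases lt_or_ge i 2 with hi | hi
      · rw [krawSum_shiftUp_of_lt he hi]
        refine ht _ _ _ fun hc => hn ?_
        simp only [Admissible, Nat.even_iff] at hc ⊢
        omega
      · obtain ⟨i, rfl⟩ := Nat.exists_eq_add_of_le' hi
        rw [krawSum_shiftUp_add_two he, mul_sub, sub_mul, ht, ht, sub_zero]
        all_goals
          refine fun hc => hn ?_
          simp only [Admissible, Nat.even_iff] at hc ⊢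
          omega

lemma CubePair.shiftUp (P : CubePair d e es) : CubePair (d + 2) (shiftUp e) (shiftUp es) where
  family := P.family.shiftUp
  familyDual := P.familyDual.shiftUp
  triple _ _ _ hn := triple_shiftUp (P.family.eq_zero _ (by omega)) P.triple hn
  tripleDual _ _ _ hn := triple_shiftUp (P.familyDual.eq_zero _ (by omega)) P.tripleDual hn

/-- The element $x_d$ has eigenvalues $(-1)^l$ and so is an involution, the antipodal map. The
relations give $e_d^*x_d=e_d^*x_de_0^*$, which vanishes with $e_0^*$; multiplying by $x_d$ recovers
$e_d^*$. -/
lemma CubePair.es_last_eq_zero (P : CubePair d e es) (h0 : es 0 = 0) : es d = 0 := by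
  have h1 : krawSum d e d * krawSum d e d = 1 := by
    conv_lhs => rw [krawSum.eq_1 d e d, mul_sum]
    rw [← P.family.sum]
    refine sum_congr rfl fun l hl => ?_
    rw [← krawSum.eq_1, mul_smul_comm, P.family.krawSum_mul, smul_smul,
      krawtchouk_self_left (by rw [mem_range] at hl; omega)]
    push_cast
    rw [← mul_pow]
    simp
  have h2 : es d * krawSum d e d = 0 := by
    rw [← mul_one (es d * krawSum d e d), ← P.familyDual.sum, mul_sum]
    refine sum_eq_zero fun j _ => ?_
    rcases Nat.eq_zero_or_pos j with rfl | hj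
    · rw [h0, mul_zero]
    · refine P.triple _ _ _ fun hc => ?_
      have := hc.2.2.2.2
      omega
  rw [← mul_one (es d), ← h1, ← mul_assoc, h2, zero_mul]

lemma triple_shiftDown (h0 : e 0 = 0) (h1 : e (d + 2) = 0)
    (ht : ∀ h i j, ¬ Admissible (d + 2) h i j → es h * krawSum (d + 2) e i * es j = 0)
    {h i j : ℕ} (hn : ¬ Admissible d h i j) :
    es (h + 1) * krawSum d (fun l => e (l + 1)) i * es (j + 1) = 0 := by
  have key1 : ∀ i, krawSum (d + 2) e (i + 2) =
      krawSum d (fun l => e (l + 1)) (i + 2) - krawSum d (fun l => e (l + 1)) i := by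
    intro i
    rw [← krawSum_shiftUp_add_two (e := fun l => e (l + 1)) h1, shiftUp_succ h0]
  have key2 : ∀ i < 2, krawSum (d + 2) e i = krawSum d (fun l => e (l + 1)) i := by
    intro i hi
    rw [← krawSum_shiftUp_of_lt (e := fun l => e (l + 1)) h1 hi, shiftUp_succ h0]
  -- These failures persist for $(h+1,i,j+1)$ in the larger cube and survive lowering $i$ by two, so
  -- the recursion for $x_i$ is run upwards from $i<2$.
  by_cases hlow : Odd (h + i + j) ∨ i + j < h ∨ h + i < j
  · clear hn
    induction i using Nat.strong_induction_on with
    | _ i ih =>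
      have hz : es (h + 1) * krawSum (d + 2) e i * es (j + 1) = 0 := by
        refine ht _ _ _ fun hc => ?_
        simp only [Admissible, Nat.even_iff] at hc
        rw [Nat.odd_iff] at hlow
        omega
      rcases lt_or_ge i 2 with hi | hi
      · rw [← key2 i hi, hz]
      · obtain ⟨i, rfl⟩ := Nat.exists_eq_add_of_le' hi
        rw [key1, mul_sub, sub_mul, ih i (by omega), sub_zero] at hz
        · exact hz
        · rw [Nat.odd_iff] at hlow ⊢
          omega
  · have hhigh : Even (h + i + j) ∧ (h + j < i ∨ 2 * d < h + i + j) := by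
      simp only [Admissible, Nat.even_iff] at hn ⊢
      rw [Nat.odd_iff] at hlow
      omega
    clear hn hlow
    -- The other failures survive raising $i$ by two, so the recursion is run downwards from indices
    -- beyond $d$, where $x_i=0$.
    obtain ⟨n, hni⟩ : ∃ n, d < i + 2 * n := ⟨d + 1, by omega⟩
    induction n generalizing i with
    | zero => rw [krawSum_eq_zero _ (by omega), mul_zero, zero_mul]
    | succ n ih =>
      have hz : es (h + 1) * krawSum (d + 2) e (i + 2) * es (j + 1) = 0 := by
        refine ht _ _ _ fun hc => ?_
        simp only [Admissible, Nat.even_iff] at hc hhigh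
        omega
      rw [key1, mul_sub, sub_mul, ih _ (by omega), zero_sub, neg_eq_zero] at hz
      · exact hz
      · rw [Nat.even_iff] at hhigh ⊢
        omega

lemma CubePair.shiftDown (P : CubePair (d + 2) e es) (h0 : e 0 = 0) (h0' : es 0 = 0) :
    CubePair d (fun l => e (l + 1)) (fun l => es (l + 1)) where
  family := P.family.shiftDown h0 (P.swap.es_last_eq_zero h0)
  familyDual := P.familyDual.shiftDown h0' (P.es_last_eq_zero h0')
  triple _ _ _ hn := triple_shiftDown h0 (P.swap.es_last_eq_zero h0) P.triple hn
  tripleDual _ _ _ hn := triple_shiftDown h0' (P.es_last_eq_zero h0') P.tripleDual hn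

end Shift

/-! ### The primary module -/

section PrimaryModule

variable (d : ℕ)

/-- The matrix of Krawtchouk numbers. -/
def krawMatrix : Matrix (Fin (d + 1)) (Fin (d + 1)) ℂ :=
  Matrix.of fun i j => (krawtchouk d i j : ℂ)

/-- The action of `e_l^*` on the primary module. -/
def matEDual (l : ℕ) : Matrix (Fin (d + 1)) (Fin (d + 1)) ℂ :=
  Matrix.diagonal fun i => if (i : ℕ) = l then 1 else 0

/-- The action of `e_l` on the primary module. -/
def matE (l : ℕ) : Matrix (Fin (d + 1)) (Fin (d + 1)) ℂ :=
  (2 ^ d : ℂ)⁻¹ • (krawMatrix d * matEDual d l * krawMatrix d)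

lemma krawMatrix_mul_self : krawMatrix d * krawMatrix d = (2 ^ d : ℂ) • 1 := by
  ext i j
  simp only [mul_apply, krawMatrix, of_apply, Matrix.smul_apply, one_apply]
  rw [Fin.sum_univ_eq_sum_range (fun l => (krawtchouk d i l : ℂ) * krawtchouk d l j),
    sum_krawtchouk_mul_krawtchouk_cast _ (by omega)]
  simp [Fin.ext_iff]

lemma idempotentFamily_matEDual : IdempotentFamily d (matEDual d) where
  mul l m := by
    simp only [matEDual, diagonal_mul_diagonal]
    split_ifs with h
    · subst h; simp
    · rw [← diagonal_zero]
      congr 1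
      ext i
      by_cases h1 : (i : ℕ) = l
      · simp [h1, h]
      · simp [h1]
  eq_zero l hl := by
    rw [matEDual, ← diagonal_zero]
    congr 1
    ext i
    exact if_neg (by omega)
  sum := by
    ext i j
    rw [Matrix.sum_apply]
    simp only [matEDual, diagonal_apply, one_apply]
    split_ifs
    · simpa using Nat.le_of_lt_succ i.2
    · simp

lemma krawMatrix_conj_mul (a b : Matrix (Fin (d + 1)) (Fin (d + 1)) ℂ) :
    (krawMatrix d * a * krawMatrix d) * (krawMatrix d * b * krawMatrix d) =
      (2 ^ d : ℂ) • (krawMatrix d * (a * b) * krawMatrix d) := by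
  calc _ = krawMatrix d * a * (krawMatrix d * krawMatrix d) * b * krawMatrix d := by
        simp only [mul_assoc]
    _ = _ := by rw [krawMatrix_mul_self]; simp [mul_assoc]

lemma idempotentFamily_matE : IdempotentFamily d (matE d) where
  mul l m := by
    rw [matE, matE, smul_mul_smul_comm, krawMatrix_conj_mul, (idempotentFamily_matEDual d).mul,
      mul_smul, inv_smul_smul₀ (pow_ne_zero _ two_ne_zero)]
    split_ifs <;> simp
  eq_zero l hl := by
    rw [matE, (idempotentFamily_matEDual d).eq_zero l hl, mul_zero, zero_mul, smul_zero]
  sum := by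
    simp only [matE]
    rw [← smul_sum, ← sum_mul, ← mul_sum, (idempotentFamily_matEDual d).sum, mul_one,
      krawMatrix_mul_self, inv_smul_smul₀ (pow_ne_zero _ two_ne_zero)]

lemma krawSum_matEDual (i : ℕ) :
    krawSum d (matEDual d) i = Matrix.diagonal fun a : Fin (d + 1) => (krawtchouk d i a : ℂ) := by
  ext a b
  rw [krawSum, Matrix.sum_apply]
  simp only [matEDual, Matrix.smul_apply, diagonal_apply]
  split_ifs
  · simpa using fun h => absurd a.2 (by omega)
  · simp

lemma krawSum_matE (i : ℕ) : krawSum d (matE d) i =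
    (2 ^ d : ℂ)⁻¹ • (krawMatrix d * krawSum d (matEDual d) i * krawMatrix d) := by
  simp only [krawSum, matE, mul_sum, sum_mul, smul_sum, mul_smul_comm, smul_mul_assoc]
  exact sum_congr rfl fun l _ => smul_comm _ _ _

/-- On the primary module $x_i$ acts by its intersection matrix, so the triple product relations
reduce to the vanishing of intersection numbers. -/
lemma krawSum_matE_apply (i : ℕ) (a b : Fin (d + 1)) :
    krawSum d (matE d) i a b = cubeParam d b a i := by
  rw [krawSum_matE, krawSum_matEDual, Matrix.smul_apply, mul_apply, cubeParam, smul_eq_mul]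
  congr 1
  rw [← Fin.sum_univ_eq_sum_range (fun m => (krawtchouk d a m : ℂ) * krawtchouk d i m *
    krawtchouk d m b)]
  simp [mul_diagonal, krawMatrix]

variable {d}

lemma cubeParam_eq_zero {h i j : ℕ} (hh : h ≤ d) (hi : i ≤ d) (hj : j ≤ d)
    (hn : ¬ Admissible d h i j) : cubeParam d h i j = 0 := by
  have := (intersectionNumber_eq_zero_iff (toFin hh) (toFin hi) (toFin hj)).2 hn
  have h2 := intersectionNumber_hypercube (toFin hh) (toFin hi) (toFin hj)
  rw [this, Nat.cast_zero] at h2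
  exact h2.symm

lemma matEDual_mul_mul_matEDual_apply (h j : ℕ) (M : Matrix (Fin (d + 1)) (Fin (d + 1)) ℂ)
    (a b : Fin (d + 1)) : (matEDual d h * M * matEDual d j) a b =
      if (a : ℕ) = h ∧ (b : ℕ) = j then M a b else 0 := by
  rw [matEDual, matEDual, mul_diagonal, diagonal_mul]
  split_ifs <;> simp_all

variable (d) in
lemma cubePair_mat : CubePair d (matE d) (matEDual d) := by
  have ht : ∀ h i j, ¬ Admissible d h i j →
      matEDual d h * krawSum d (matE d) i * matEDual d j = 0 := by
    intro h i j hn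
    ext a b
    rw [matEDual_mul_mul_matEDual_apply]
    split_ifs with hab
    · rcases lt_or_ge d i with hi | hi
      · rw [krawSum_eq_zero _ hi]
      · rw [krawSum_matE_apply, hab.1, hab.2]
        refine cubeParam_eq_zero (by omega) (by omega) hi fun hc => hn ?_
        simp only [Admissible, Nat.even_iff] at hc ⊢
        omega
    · rfl
  refine ⟨idempotentFamily_matE d, idempotentFamily_matEDual d, ht, fun h i j hn => ?_⟩
  -- Conjugation by the Krawtchouk matrix exchanges the two families up to scalars, which carries
  -- `ht` to the dual relation.
  have h2 : matE d h * krawSum d (matEDual d) i * matE d j =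
      (2 ^ d : ℂ)⁻¹ • (krawMatrix d * (matEDual d h * krawSum d (matE d) i * matEDual d j) *
        krawMatrix d) := by
    simp only [krawSum_matE, matE, smul_mul_assoc, mul_smul_comm, mul_assoc]
  rw [h2, ht h i j hn, mul_zero, zero_mul, smul_zero]

lemma matE_zero_apply (a b : Fin (d + 1)) : matE d 0 a b = (2 ^ d : ℂ)⁻¹ * d.choose a := by
  rw [matE, Matrix.smul_apply, matEDual, mul_apply, sum_eq_single_of_mem 0 (mem_univ _)]
  · rw [mul_diagonal]
    simp [krawMatrix, krawtchouk_zero_left, krawtchouk_zero_right]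
  · intro l _ hl
    rw [mul_diagonal, if_neg (Fin.val_ne_zero_iff.2 hl), mul_zero, zero_mul]

/-- The matrix `matE d 0` has no zero entry, so cutting it on both sides by diagonal idempotents
yields a nonzero multiple of every matrix unit. -/
lemma matEDual_mul_matE_zero_mul_matEDual {h j : Fin (d + 1)} :
    matEDual d h * matE d 0 * matEDual d j =
      ((2 ^ d : ℂ)⁻¹ * d.choose h) • Matrix.single h j 1 := by
  ext a b
  rw [matEDual_mul_mul_matEDual_apply, matE_zero_apply, Matrix.smul_apply, single_apply]
  simp only [Fin.val_inj]
  split_ifs with h1 h2 h2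
  · rw [h1.1]; simp
  · exact absurd ⟨h1.1.symm, h1.2.symm⟩ h2
  · exact absurd ⟨h2.1.symm, h2.2.symm⟩ h1
  · simp

lemma primaryIdempotent_mat : primaryIdempotent d (matE d) (matEDual d) = 1 := by
  have h0 : (2 : ℂ) ^ d ≠ 0 := pow_ne_zero _ two_ne_zero
  rw [primaryIdempotent, smul_sum, ← (idempotentFamily_matEDual d).sum]
  refine sum_congr rfl fun i hi => ?_
  have h2 : (d.choose i : ℂ) ≠ 0 := by
    exact_mod_cast (Nat.choose_pos (by rw [mem_range] at hi; omega)).ne'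
  have h3 := matEDual_mul_matE_zero_mul_matEDual (h := ⟨i, mem_range.1 hi⟩)
    (j := ⟨i, mem_range.1 hi⟩)
  simp only at h3
  rw [h3, smul_smul, smul_smul]
  rw [show (2 ^ d : ℂ) * (d.choose i : ℂ)⁻¹ * ((2 ^ d)⁻¹ * d.choose i) = 1 by field_simp, one_smul]
  ext a b
  simp only [matEDual, single_apply, diagonal_apply, Fin.ext_iff]
  split_ifs <;> first | rfl | omega

end PrimaryModule

/-! ### The decomposition of the generalized Terwilliger algebra of the cube -/

section Decomposition

variable {d : ℕ}

lemma primaryIdempotent_mem_center : primaryIdempotent d (cubeE d) (cubeEDual d) ∈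
    Subalgebra.center ℂ (CubeAlgebra d) := by
  have P := cubePair_cube d
  have h : Subalgebra.centralizer ℂ {primaryIdempotent d (cubeE d) (cubeEDual d)} = ⊤ := by
    refine cubeAlgebra_subalgebra_eq_top (fun i => ?_) (fun i => ?_) <;>
      rw [Subalgebra.mem_centralizer_iff] <;> rintro _ rfl
    · exact P.commute_primaryIdempotent_e i
    · exact P.commute_primaryIdempotent_es i
  rw [Subalgebra.mem_center_iff]
  intro b
  have hb : b ∈ Subalgebra.centralizer ℂ {primaryIdempotent d (cubeE d) (cubeEDual d)} := by
    rw [h]; trivial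
  exact ((Subalgebra.mem_centralizer_iff ℂ).1 hb _ rfl).symm

/-- The span of the elements `e_h^* e_0 e_j^*`. -/
def primarySpan (d : ℕ) : Submodule ℂ (CubeAlgebra d) :=
  Submodule.span ℂ {a | ∃ h j : ℕ, h ≤ d ∧ j ≤ d ∧ a = cubeEDual d h * cubeE d 0 * cubeEDual d j}

lemma mem_primarySpan (h j : ℕ) :
    cubeEDual d h * cubeE d 0 * cubeEDual d j ∈ primarySpan d := by
  rcases le_or_gt h d with hh | hh
  · rcases le_or_gt j d with hj | hj
    · exact Submodule.subset_span ⟨h, j, hh, hj, rfl⟩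
    · rw [cubeEDual_eq_zero hj, mul_zero]
      exact zero_mem _
  · rw [cubeEDual_eq_zero hh, zero_mul, zero_mul]
    exact zero_mem _

lemma primaryIdempotent_mem_primarySpan :
    primaryIdempotent d (cubeE d) (cubeEDual d) ∈ primarySpan d :=
  Submodule.smul_mem _ _ (Submodule.sum_mem _ fun i _ =>
    Submodule.smul_mem _ _ (mem_primarySpan i i))

/-- The elements mapping `primarySpan d` into itself by left multiplication. -/
def primarySpanStabilizer (d : ℕ) : Subalgebra ℂ (CubeAlgebra d) where
  carrier := {a | ∀ n ∈ primarySpan d, a * n ∈ primarySpan d}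
  mul_mem' ha hb n hn := by rw [mul_assoc]; exact ha _ (hb _ hn)
  add_mem' ha hb n hn := by rw [add_mul]; exact add_mem (ha _ hn) (hb _ hn)
  algebraMap_mem' r n hn := by
    rw [← Algebra.smul_def]; exact Submodule.smul_mem _ _ hn

lemma mem_primarySpanStabilizer_of_generators {a : CubeAlgebra d}
    (ha : ∀ h ≤ d, ∀ j ≤ d, a * (cubeEDual d h * cubeE d 0 * cubeEDual d j) ∈ primarySpan d) :
    a ∈ primarySpanStabilizer d := by
  intro n hn
  induction hn using Submodule.span_induction with
  | mem x hx =>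
    obtain ⟨h, j, hh, hj, rfl⟩ := hx
    exact ha h hh j hj
  | zero => rw [mul_zero]; exact zero_mem _
  | add x y _ _ hx hy => rw [mul_add]; exact add_mem hx hy
  | smul r x _ hx => rw [mul_smul_comm]; exact Submodule.smul_mem _ _ hx

/-- Stability under the $e_h^*$ is immediate. For $e_m$, `CubePair.es_mul_e_zero` reduces
$e_me_h^*e_0$ to a multiple of $e_me_0^*e_0$. -/
lemma primarySpanStabilizer_eq_top : primarySpanStabilizer d = ⊤ := by
  have P := cubePair_cube d
  refine cubeAlgebra_subalgebra_eq_top (fun m => ?_) (fun m => ?_) <;>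
    refine mem_primarySpanStabilizer_of_generators fun h hh j hj => ?_
  · rcases lt_or_ge d m with hm | hm
    · rw [cubeE_eq_zero hm, zero_mul]
      exact zero_mem _
    rw [P.es_mul_e_zero hh, ← mul_assoc, mul_sum,
      sum_eq_single_of_mem m (by rw [mem_range]; omega) (fun l _ hl => by
        rw [mul_smul_comm, mul_assoc (cubeE d l), ← mul_assoc, P.family.mul, if_neg hl.symm,
          zero_mul, smul_zero]),
      mul_smul_comm, mul_assoc (cubeE d m), ← mul_assoc, P.family.mul, if_pos rfl]
    -- The element $e_me_0^*e_0$ is $2^{-d}x_m^*e_0$, and expanding $x_m^*$ in the $e_l^*$ leads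
    -- back into the span.
    have h1 := P.swap.krawSum_mul_es_zero hm
    rw [mul_assoc (cubeE d m)] at h1
    rw [← inv_smul_eq_iff₀ (pow_ne_zero _ two_ne_zero)] at h1
    rw [← h1, krawSum, sum_mul, smul_mul_assoc, smul_mul_assoc, sum_mul]
    refine Submodule.smul_mem _ _ (Submodule.smul_mem _ _ (Submodule.sum_mem _ fun l _ => ?_))
    rw [smul_mul_assoc, smul_mul_assoc]
    exact Submodule.smul_mem _ _ (mem_primarySpan l j)
  · rw [← mul_assoc, ← mul_assoc, P.familyDual.mul]
    split_ifs
    · exact mem_primarySpan m j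
    · rw [zero_mul, zero_mul]
      exact zero_mem _

lemma mul_primaryIdempotent_mem_primarySpan (a : CubeAlgebra d) :
    a * primaryIdempotent d (cubeE d) (cubeEDual d) ∈ primarySpan d := by
  have ha : a ∈ primarySpanStabilizer d := by rw [primarySpanStabilizer_eq_top]; trivial
  exact ha _ primaryIdempotent_mem_primarySpan

/-- The linear map from matrices to `𝒯_d` sending matrix units to multiples of the elements
`e_h^* e_0 e_j^*`. -/
def ofMatrix (d : ℕ) : Matrix (Fin (d + 1)) (Fin (d + 1)) ℂ →ₗ[ℂ] CubeAlgebra d where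
  toFun m := ∑ h, ∑ j, (m h j * ((2 ^ d : ℂ)⁻¹ * d.choose h)⁻¹) •
    (cubeEDual d h * cubeE d 0 * cubeEDual d j)
  map_add' m n := by simp [add_mul, add_smul, sum_add_distrib]
  map_smul' r m := by simp [mul_assoc, mul_smul, smul_sum]

lemma choose_scalar_ne_zero {h : ℕ} (hh : h ≤ d) : (2 ^ d : ℂ)⁻¹ * d.choose h ≠ 0 := by
  have : (d.choose h : ℂ) ≠ 0 := by exact_mod_cast (Nat.choose_pos hh).ne'
  exact mul_ne_zero (inv_ne_zero (pow_ne_zero _ two_ne_zero)) this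

section

variable {f : CubeAlgebra d →ₐ[ℂ] Matrix (Fin (d + 1)) (Fin (d + 1)) ℂ}
  (he : ∀ i, f (cubeE d i) = matE d i) (hes : ∀ i, f (cubeEDual d i) = matEDual d i)

include he hes

lemma map_ofMatrix (m : Matrix (Fin (d + 1)) (Fin (d + 1)) ℂ) : f (ofMatrix d m) = m := by
  rw [ofMatrix, LinearMap.coe_mk, AddHom.coe_mk]
  simp only [map_sum, map_smul, map_mul, he, hes, matEDual_mul_matE_zero_mul_matEDual, smul_smul]
  conv_rhs => rw [matrix_eq_sum_single m]
  refine sum_congr rfl fun h _ => sum_congr rfl fun j _ => ?_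
  rw [inv_mul_cancel_right₀ (choose_scalar_ne_zero (by omega)), smul_single, smul_eq_mul, mul_one]

lemma ofMatrix_map_of_mem_primarySpan {a : CubeAlgebra d} (ha : a ∈ primarySpan d) :
    ofMatrix d (f a) = a := by
  induction ha using Submodule.span_induction with
  | mem x hx =>
    obtain ⟨h, j, hh, hj, rfl⟩ := hx
    have h1 := matEDual_mul_matE_zero_mul_matEDual (h := (⟨h, by omega⟩ : Fin (d + 1)))
      (j := ⟨j, by omega⟩)
    simp only at h1
    rw [map_mul f, map_mul f, he, hes, hes, h1, map_smul, ofMatrix, LinearMap.coe_mk, AddHom.coe_mk,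
      sum_eq_single_of_mem ⟨h, by omega⟩ (mem_univ _),
      sum_eq_single_of_mem ⟨j, by omega⟩ (mem_univ _)]
    · rw [single_apply_same, one_mul, smul_inv_smul₀ (choose_scalar_ne_zero hh)]
    · intro b _ hb
      rw [single_apply_of_ne, zero_mul, zero_smul]
      simp [hb.symm]
    · intro b _ hb
      refine sum_eq_zero fun c _ => ?_
      rw [single_apply_of_ne, zero_mul, zero_smul]
      simp [hb.symm]
  | zero => simp
  | add x y _ _ hx hy => rw [map_add, map_add, hx, hy]
  | smul r x _ hx => rw [map_smul, map_smul, hx]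

end

/-- The kernel of `f` lies in the ideal of $u_0$: by `CubePair.shiftDown` and the universal
property, the quotient map modulo $u_0$ factors as `g.comp f`. -/
lemma mul_primaryIdempotent_eq_self_of_map_eq_zero {n : ℕ}
    {f : CubeAlgebra (n + 2) →ₐ[ℂ] CubeAlgebra n}
    (he : ∀ i, f (cubeE (n + 2) i) = shiftUp (cubeE n) i)
    (hes : ∀ i, f (cubeEDual (n + 2) i) = shiftUp (cubeEDual n) i)
    {a : CubeAlgebra (n + 2)} (ha : f a = 0) :
    a * primaryIdempotent (n + 2) (cubeE (n + 2)) (cubeEDual (n + 2)) = a := by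
  have P := cubePair_cube (n + 2)
  have hI := P.isIdempotentElem_primaryIdempotent
  set u := primaryIdempotent (n + 2) (cubeE (n + 2)) (cubeEDual (n + 2)) with hu
  have hc : ∀ b, b * u = u * b := fun b =>
    Subalgebra.mem_center_iff.1 (primaryIdempotent_mem_center (d := n + 2)) b
  have hmem : ∀ b, b ∈ Ideal.span {u} ↔ b * u = b := by
    intro b
    rw [Ideal.mem_span_singleton']
    constructor
    · rintro ⟨c, rfl⟩
      rw [mul_assoc, hI.eq]
    · exact fun h => ⟨b, h⟩
  -- `Ideal.span` is a left ideal; centrality of `u` makes it two-sided, so that the quotient is a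
  -- ring.
  have : (Ideal.span {u}).IsTwoSided := ⟨fun {b} c hb => by
    rw [hmem] at hb ⊢
    rw [mul_assoc, hc c, ← mul_assoc, hb]⟩
  set π := Ideal.Quotient.mkₐ ℂ (Ideal.span {u}) with hπ
  have hker : ∀ b, π b = 0 ↔ b * u = b := by
    intro b
    rw [hπ, Ideal.Quotient.mkₐ_eq_mk, Ideal.Quotient.eq_zero_iff_mem, hmem]
  have h0 : π (cubeE (n + 2) 0) = 0 := (hker _).2 P.e_zero_mul_primaryIdempotent
  have h0' : π (cubeEDual (n + 2) 0) = 0 := by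
    rw [hker, hu, P.primaryIdempotent_eq_dual]
    exact P.swap.e_zero_mul_primaryIdempotent
  obtain ⟨g, hg1, hg2⟩ := ((P.map π).shiftDown h0 h0').exists_lift
  have hgf : g.comp f = π := by
    refine cubeAlgebra_algHom_ext (fun i => ?_) (fun i => ?_)
    · rw [AlgHom.comp_apply, he]
      cases i with
      | zero => rw [shiftUp, map_zero, h0]
      | succ i => rw [shiftUp, hg1]
    · rw [AlgHom.comp_apply, hes]
      cases i with
      | zero => rw [shiftUp, map_zero, h0']
      | succ i => rw [shiftUp, hg2]
  rw [← hker, ← hgf, AlgHom.comp_apply, ha, map_zero]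

lemma map_primaryIdempotent {A B : Type*} [Ring A] [Algebra ℂ A] [Ring B] [Algebra ℂ B]
    (f : A →ₐ[ℂ] B) (d : ℕ) (e es : ℕ → A) : f (primaryIdempotent d e es) =
      primaryIdempotent d (fun i => f (e i)) (fun i => f (es i)) := by
  simp [primaryIdempotent, map_sum]

theorem exists_algEquiv_matrix_prod (n : ℕ) : ∃ Ψ : CubeAlgebra (n + 2) ≃ₐ[ℂ]
    Matrix (Fin (n + 2 + 1)) (Fin (n + 2 + 1)) ℂ × CubeAlgebra n,
    Ψ (primaryIdempotent (n + 2) (cubeE (n + 2)) (cubeEDual (n + 2))) = (1, 0) := by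
  obtain ⟨f, hf1, hf2⟩ := (cubePair_mat (n + 2)).exists_lift
  obtain ⟨g, hg1, hg2⟩ := (cubePair_cube n).shiftUp.exists_lift
  have hfu : f (primaryIdempotent (n + 2) (cubeE (n + 2)) (cubeEDual (n + 2))) = 1 := by
    rw [map_primaryIdempotent, ← primaryIdempotent_mat]
    simp only [hf1, hf2]
  have hgu : g (primaryIdempotent (n + 2) (cubeE (n + 2)) (cubeEDual (n + 2))) = 0 := by
    rw [map_primaryIdempotent, primaryIdempotent]
    simp [hg1, shiftUp]
  have hgs : Function.Surjective g := by
    rw [← AlgHom.range_eq_top]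
    exact cubeAlgebra_subalgebra_eq_top (fun i => ⟨cubeE (n + 2) (i + 1), hg1 _⟩)
      (fun i => ⟨cubeEDual (n + 2) (i + 1), hg2 _⟩)
  set u := primaryIdempotent (n + 2) (cubeE (n + 2)) (cubeEDual (n + 2)) with hu
  have hbij : Function.Bijective (f.prod g) := by
    constructor
    · rw [injective_iff_map_eq_zero]
      intro a ha
      have ha1 : f a = 0 := congrArg Prod.fst ha
      have ha2 : g a = 0 := congrArg Prod.snd ha
      -- Since `g a = 0`, the element `a` equals `a * u` and lies in `primarySpan`, where `ofMatrix`
      -- recovers it from its image under `f`.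
      rw [← mul_primaryIdempotent_eq_self_of_map_eq_zero hg1 hg2 ha2,
        ← ofMatrix_map_of_mem_primarySpan hf1 hf2 (mul_primaryIdempotent_mem_primarySpan a),
        map_mul, ha1, zero_mul, map_zero]
    · rintro ⟨m, t⟩
      obtain ⟨b, rfl⟩ := hgs t
      -- Since `f u = 1` and `g u = 0`, the factor `u` isolates the matrix component and `1 - u` the
      -- other one.
      refine ⟨ofMatrix _ m * u + b * (1 - u), ?_⟩
      rw [AlgHom.prod_apply]
      simp [hfu, hgu, map_ofMatrix hf1 hf2]
  exact ⟨AlgEquiv.ofBijective _ hbij, Prod.ext hfu hgu⟩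

end Decomposition

/-! ### Two-sided ideals attached to a product decomposition -/

section Ideal

variable {A B C : Type*} [Ring A] [Ring B] [Ring C]

lemma mem_span_iff_snd_eq_zero (Ψ : A ≃+* B × C) {u : A} (hu : Ψ u = (1, 0)) (a : A) :
    a ∈ TwoSidedIdeal.span {u} ↔ (Ψ a).2 = 0 := by
  constructor
  · intro ha
    have h : TwoSidedIdeal.span {u} ≤
        TwoSidedIdeal.ker ((RingHom.snd B C).comp (Ψ : A →+* B × C)) := by
      rw [TwoSidedIdeal.span_le, Set.singleton_subset_iff]
      simp [TwoSidedIdeal.mem_ker, hu]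
    exact (TwoSidedIdeal.mem_ker _).1 (h ha)
  · intro ha
    -- Multiplication by `u` is the projection to the first factor, which fixes every element with
    -- vanishing second component.
    have : a = a * u := Ψ.injective (by rw [map_mul, hu]; ext <;> simp [ha])
    rw [this]
    exact TwoSidedIdeal.mul_mem_left _ _ _ (TwoSidedIdeal.subset_span rfl)

lemma mem_span_iff_fst_eq_zero (Ψ : A ≃+* B × C) {u : A} (hu : Ψ u = (1, 0)) (a : A) :
    a ∈ TwoSidedIdeal.span {1 - u} ↔ (Ψ a).1 = 0 :=
  mem_span_iff_snd_eq_zero (Ψ.trans RingEquiv.prodComm) (by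
    rw [RingEquiv.trans_apply, map_sub, map_one, hu]; ext <;> simp) a

end Ideal

end

end Terwilliger

theorem mainTheorem3 (d : ℕ) (hd : 2 ≤ d) :
    Terwilliger.u₀ (Terwilliger.hypercube d) = Terwilliger.u₀Dual (Terwilliger.hypercube d) ∧
    IsIdempotentElem (Terwilliger.u₀ (Terwilliger.hypercube d)) ∧
    Terwilliger.u₀ (Terwilliger.hypercube d) ∈ Subalgebra.center ℂ (Terwilliger.CubeAlgebra d) ∧
    ∃ Ψ : Terwilliger.CubeAlgebra d ≃ₐ[ℂ]
        Matrix (Fin (d + 1)) (Fin (d + 1)) ℂ × Terwilliger.CubeAlgebra (d - 2),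
      Ψ (Terwilliger.u₀ (Terwilliger.hypercube d)) = (1, 0) ∧
      (∀ a, a ∈ TwoSidedIdeal.span {Terwilliger.u₀ (Terwilliger.hypercube d)} ↔ (Ψ a).2 = 0) ∧
      (∀ a, a ∈ TwoSidedIdeal.span {1 - Terwilliger.u₀ (Terwilliger.hypercube d)} ↔
        (Ψ a).1 = 0) := by
  obtain ⟨n, rfl⟩ := Nat.exists_eq_add_of_le' hd
  have P := Terwilliger.cubePair_cube (n + 2)
  rw [Terwilliger.u₀_hypercube, Terwilliger.u₀Dual_hypercube]
  refine ⟨P.primaryIdempotent_eq_dual, P.isIdempotentElem_primaryIdempotent,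
    Terwilliger.primaryIdempotent_mem_center, ?_⟩
  obtain ⟨Ψ, hΨ⟩ := Terwilliger.exists_algEquiv_matrix_prod n
  exact ⟨Ψ, hΨ, Terwilliger.mem_span_iff_snd_eq_zero Ψ.toRingEquiv hΨ,
    Terwilliger.mem_span_iff_fst_eq_zero Ψ.toRingEquiv hΨ⟩
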